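/- **Setting.** Let $H\subset X$ be real Hilbert spaces, with $H$ dense in $X$ and $\|v\|_X\le C_\iota\|v\|_H$; let $X_0\subset X$ be a closed subspace of finite codimension with orthogonal projection $\Pi_0$, put $H_0=H\cap X_0$, and let ${\rm J}:H\to\mathbb R$ be of class $C^2$. For $u,v,w\in H$ write $\langle\nabla_X{\rm J}(u),w\rangle_X:=D{\rm J}(u)w$ and $\langle\nabla_X^2{\rm J}(u)v,w\rangle_X:=D^2{\rm J}(u)(v,w)$; $\nabla_X{\rm J}(u)$ is an element of $X$ when the first functional is represented by one. Let $\mathcal P\subset\mathcal U\subset\mathbb R^n$, where $\mathcal U$ contains the ball $B(p,\rho)$ for every $p\in\mathcal P$, with a fixed $\rho>0$ (so one may take $\mathcal U=\mathcal P$ if $\mathcal P=\mathbb R^n$). Let $\Phi:\mathcal U\to H$ be of class $C^1$ (near each point of $\mathcal U$) and uniformly embedded: $\|\Phi(p)-\Phi(q)\|_H\ge m(\varepsilon)$ whenever $p,q\in\mathcal U$, $|p-q|\ge\varepsilon>0$, with a given function $m>0$. Put $\mathcal M=\Phi(\mathcal P)$. The base flow is $u_t=F(u):=-\Pi_0\nabla_X{\rm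 J}(u)$, where $F(u)$ is regarded as a functional on $H_0\subset X_0\subset H_0'$. For $p\in\mathcal U$ let $\mathcal R(p)=F(\Phi(p))$, and let $\mathbb L_p=-\Pi_0\nabla^2_X{\rm J}(\Phi(p))$ be regarded as an operator of $X_0$ with domain $\{v\in H_0:\mathbb L_pv\in X_0\}$. Let $\delta>0$ and suppose that the following hold for all $p\in\mathcal U$, with positive constants $\varepsilon_S,C_S,C_0,c_0,k_s,C_2,C_3,C_4,\gamma_e,\mu_e$ and $r>1$. * (Nonlinearity) For $v\in H_0$, $\|v\|_H\le\varepsilon_S$, one has $F(\Phi(p)+v)=\mathcal R(p)+\mathbb L_pv+\mathcal N_S(p,v)$ with $\mathcal N_S(p,v)\in H_0$ and $\|\mathcal N_S(p,v)\|_H\le C_S\|v\|_H^r$. * (H0) $\mathcal R(p)\in H_0$ and $\|\mathcal R(p)\|_H\le C_0\delta$. * (H1) The spectrum of $\mathbb L_p$ lies in $(-\infty,-k_s]\cup[-c_0\delta,c_0\delta]$, and the slow eigenspace $Y_p$, spanned by the eigenvectors with eigenvalue in $[-c_0\delta,c_0\delta]$, has dimension $n$. * (H2) $\mathbb L_p$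 generates a $C_0$ semigroup $S_p$ on $X_0$ with $\|S_p(t)u\|_H\le C_2e^{-k_st}\|u\|_H$ for $t\ge0$ and $u\in H_0$ with $u\perp_XY_p$. * (H3), (H4) There are eigenvectors $\psi_1(p),\dots,\psi_n(p)$ of $\mathbb L_p$ in $Y_p$, orthonormal in $X$ and $C^2$ in $p$ as maps into $H$, with $\|\psi_i(p)-\partial_{p_i}\Phi(p)\|_H\le C_3\delta$ and $\|\psi_i(p)\|_H+\|\nabla_p^2\psi_i(p)\|_H\le C_4$. * (EH1) $\Phi(p)\in a+X_0$ for a fixed $a\in H$. * (EA) $\langle(\nabla_X^2{\rm J}(\Phi(p))+\gamma_e)v,v\rangle_X\ge\mu_e\|v\|_H^2$ for all $v\in H_0$. **Theorem.** There are $\delta_{\max},\eta,c_1,K,\mu_2,c_2>0$ and $\varrho>2$, depending only on $n,\rho,m,C_\iota,r$ and the constants above, such that the following holds whenever $\delta\le\delta_{\max}$. Let $\delta_2=K\delta$ and $\mathcal N_\eta=\{u\in H:\ u-a\in X_0,\ d_H(u,\mathcal M)<\eta\}$. (1) There is a continuous map $\hat p:\mathcal N_\eta\to\mathcal U$ such that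 $\Pi_{\mathcal M}u:=\Phi(\hat p(u))$ is a projection onto the manifold ($\hat p(\Phi(q))=q$ whenever $q\in\mathcal U$, $\Phi(q)\in\mathcal N_\eta$), and such that, for every $u\in\mathcal N_\eta$, with $w=u-\Pi_{\mathcal M}u$: * (A1) $\|w\|_H\le c_1d_H(u,\mathcal M)$; * (A2) ${\rm J}(u)={\rm J}(\Pi_{\mathcal M}u)+\langle\nabla_X{\rm J}(\Pi_{\mathcal M}u),w\rangle_X+\tfrac12\langle\nabla_X^2{\rm J}(\Pi_{\mathcal M}u)w,w\rangle_X+\mathcal N_E$ with $|\langle\nabla_X{\rm J}(\Pi_{\mathcal M}u),w\rangle_X|\le\delta_2\|w\|_H$, $\ \tfrac12\langle\nabla_X^2{\rm J}(\Pi_{\mathcal M}u)w,w\rangle_X\ge\mu_2\|w\|_H^2$ and $|\mathcal N_E|\le c_2\|w\|_H^{\varrho}$. (2) Let $\delta_0,\delta_1>0$ and suppose that (A0) $|{\rm J}(u_1)-{\rm J}(u_2)|\le\delta_0$ for all $u_1,u_2\in\mathcal M$, and that $\eta_*<\eta^*$, where $$\eta^*=\min\Big\{\eta,\frac1{c_1}\Big(\frac{\mu_2}{2c_2}\Big)^{\frac1{\varrho-2}}\Big\},\qquad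 \eta_*=\frac{\delta_2}{\mu_2}+\sqrt{\frac{\delta_2^2}{\mu_2^2}+2\,\frac{\delta_0+\delta_1}{\mu_2}} .$$ Let $\mathcal G$ be any nonnegative self-adjoint operator of $X$ with kernel $X_0^\perp$ whose inverse $X_0\to X_0$ is defined on all of $X_0$ and bounded in $X$. Let $u$ be a solution of $u_t=-\mathcal G\nabla_X{\rm J}(u)$ on $[0,\tau)$, i.e. continuous into $H$ on $[0,\tau)$, and on $(0,\tau)$ differentiable into $H$ with $\nabla_X{\rm J}(u)\in X$ in the domain of $\mathcal G$ and the equation satisfied. Suppose that $u(0)\in a+X_0$, $d_H(u(0),\mathcal M)<\eta^*$ and ${\rm J}(u(0))\le\sup_{\mathcal M}{\rm J}+\delta_1$. Write $p(t)=\hat p(u(t))$ as long as $u(t)\in\mathcal N_\eta$, and let $T_{\rm exit}\le\tau$ be the infimum of the times $t\in[0,\tau)$ at which $p(t)$ is defined and $p(t)\notin\mathcal P$ ($T_{\rm exit}=\tau$ if there are none). Then for all $t\in[0,T_{\rm exit})$ one has $u(t)\in\mathcal N_\eta$, $p(t)\in\mathcal P$ is continuous in $t$, and $u(t)=\Phi(p(t))+w(t)$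 with $\|w(t)\|_H\le\eta_*$. -/

import Mathlib

open Set Filter Topology

noncomputable section

namespace SlowFlow

/-- The parameter space `ℝⁿ`. -/
abbrev Param (n : ℕ) : Type := EuclideanSpace ℝ (Fin n)

/-- The common setting: Hilbert spaces `H ⊂ X`, a closed subspace `X₀ ⊂ X` of finite codimension,
an energy `J` on `H`, and a manifold given by a parametrization `Φ` over a set `dom ⊂ ℝⁿ`. -/
structure Framework (n : ℕ) (H X : Type*)
    [NormedAddCommGroup H] [InnerProductSpace ℝ H] [CompleteSpace H]
    [NormedAddCommGroup X] [InnerProductSpace ℝ X] [CompleteSpace X] where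
  /-- the embedding of `H` into `X` -/
  ι : H →L[ℝ] X
  ι_injective : Function.Injective ι
  ι_dense : DenseRange ι
  /-- the subspace `X₀` -/
  X₀ : Submodule ℝ X
  X₀_closed : IsClosed (X₀ : Set X)
  X₀_codim : FiniteDimensional ℝ X₀ᗮ
  /-- the energy -/
  J : H → ℝ
  J_smooth : ContDiff ℝ 2 J
  /-- the parameters for which `Φ` is defined -/
  dom : Set (Param n)
  /-- the parametrization of the manifold -/
  Φ : Param n → H
  Φ_smooth : ∀ p ∈ dom, ContDiffAt ℝ 1 Φ p

section Framework

variable {n : ℕ} {H X : Type*}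
  [NormedAddCommGroup H] [InnerProductSpace ℝ H] [CompleteSpace H]
  [NormedAddCommGroup X] [InnerProductSpace ℝ X] [CompleteSpace X]

namespace Framework

variable (S : Framework n H X)

/-- The space `H ∩ X₀`, as a subspace of `H`. -/
def H₀ : Submodule ℝ H := S.X₀.comap S.ι.toLinearMap

/-- The first variation `⟨∇_X J(u), w⟩_X`, for `u, w ∈ H`. -/
def dJ (u w : H) : ℝ := fderiv ℝ S.J u w

/-- The second variation `⟨∇²_X J(u) v, w⟩_X`, for `u, v, w ∈ H`. -/
def d2J (u v w : H) : ℝ := fderiv ℝ (fderiv ℝ S.J) u v w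

/-- `g ∈ X` is the variational derivative `∇_X J(u)`. -/
def IsXGradient (u : H) (g : X) : Prop := ∀ w : H, S.dJ u w = inner ℝ g (S.ι w)

/-! The vector field of the base flow is `F = -Π₀ ∇_X J`. It is read in the triple
`H ∩ X₀ ⊂ X₀ ⊂ (H ∩ X₀)'`: its value at `u` is the functional `w ↦ -⟨∇_X J(u), w⟩_X` on `H ∩ X₀`,
and `f ∈ X₀` is identified with `w ↦ ⟨f, w⟩_X`. -/

/-- `R ∈ H ∩ X₀` is the residual `F(Φ(p))`. -/
def IsResidual (p : Param n) (R : H) : Prop :=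
  R ∈ S.H₀ ∧ ∀ w ∈ S.H₀, -S.dJ (S.Φ p) w = inner ℝ (S.ι R) (S.ι w)

/-- `v` is in the domain of the operator `𝕃_p = -Π₀ ∇²_X J(Φ(p))` of `X₀` and `𝕃_p v = f`;
the domain consists of those `v ∈ H ∩ X₀` for which the right side lies in `X₀`. -/
def IsLin (p : Param n) (v : H) (f : X) : Prop :=
  v ∈ S.H₀ ∧ f ∈ S.X₀ ∧ ∀ w ∈ S.H₀, -S.d2J (S.Φ p) v w = inner ℝ f (S.ι w)

/-- `N ∈ H ∩ X₀` is the nonlinear remainder `F(Φ(p) + v) - F(Φ(p)) - 𝕃_p v`. -/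
def IsRemainder (p : Param n) (v N : H) : Prop :=
  N ∈ S.H₀ ∧ ∀ w ∈ S.H₀,
    -S.dJ (S.Φ p + v) w = -S.dJ (S.Φ p) w - S.d2J (S.Φ p) v w + inner ℝ (S.ι N) (S.ι w)

/-- `lam` is in the resolvent set of `𝕃_p`: `lam - 𝕃_p` is a bijection from the domain onto `X₀`
with bounded inverse. -/
def InResolventSet (p : Param n) (lam : ℝ) : Prop :=
  (∀ v : H, S.IsLin p v (lam • S.ι v) → v = 0) ∧
  ∃ C : ℝ, ∀ g ∈ S.X₀, ∃ v : H, S.IsLin p v (lam • S.ι v - g) ∧ ‖S.ι v‖ ≤ C * ‖g‖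

/-- The (real) spectrum of `𝕃_p`. -/
def linSpectrum (p : Param n) : Set ℝ := {lam | ¬ S.InResolventSet p lam}

/-- `v` is an eigenvector of `𝕃_p` (or zero) with an eigenvalue in `[-s, s]`. -/
def IsSlowVector (p : Param n) (s : ℝ) (v : H) : Prop :=
  ∃ lam : ℝ, |lam| ≤ s ∧ S.IsLin p v (lam • S.ι v)

/-- The slow eigenspace `Y_p`. -/
def slowSpace (p : Param n) (s : ℝ) : Submodule ℝ H :=
  Submodule.span ℝ {v | S.IsSlowVector p s v}

/-- `T` is a `C₀` semigroup on `X₀` with generator `𝕃_p`. -/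
structure IsSemigroupOf (p : Param n) (T : ℝ → S.X₀ →L[ℝ] S.X₀) : Prop where
  zero : T 0 = ContinuousLinearMap.id ℝ S.X₀
  add : ∀ s t : ℝ, 0 ≤ s → 0 ≤ t → T (s + t) = (T s).comp (T t)
  cont : ∀ x : S.X₀, Tendsto (fun t => T t x) (𝓝[>] 0) (𝓝 x)
  gen : ∀ x f : S.X₀, Tendsto (fun t : ℝ => t⁻¹ • (T t x - x)) (𝓝[>] 0) (𝓝 f) ↔
    ∃ v : H, S.ι v = x ∧ S.IsLin p v f

/-- The nonlinearity of `F` is of order `r`, uniformly on the manifold. -/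
def NonlinearBound (εS CS r : ℝ) : Prop :=
  ∀ p ∈ S.dom, ∀ v ∈ S.H₀, ‖v‖ ≤ εS → ∃ N : H, S.IsRemainder p v N ∧ ‖N‖ ≤ CS * ‖v‖ ^ r

/-- (H0): the manifold is quasi-steady. -/
def H0 (C₀ δ : ℝ) : Prop := ∀ p ∈ S.dom, ∃ R : H, S.IsResidual p R ∧ ‖R‖ ≤ C₀ * δ

/-- (H1): the spectrum splits into a stable part and a slow part, and the slow eigenspace has
dimension `n`. -/
def H1 (ks c₀ δ : ℝ) : Prop :=
  ∀ p ∈ S.dom, S.linSpectrum p ⊆ Iic (-ks) ∪ {lam | |lam| ≤ c₀ * δ} ∧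
    Module.rank ℝ (S.slowSpace p (c₀ * δ)) = n

/-- (H2): `𝕃_p` generates a `C₀` semigroup that decays in the norm of `H` on
`Y_p' = Y_p^⊥ ∩ H`. -/
def H2 (ks c₀ δ C₂ : ℝ) : Prop :=
  ∀ p ∈ S.dom, ∃ T : ℝ → S.X₀ →L[ℝ] S.X₀, S.IsSemigroupOf p T ∧
    ∀ u (hu : u ∈ S.H₀), (∀ y ∈ S.slowSpace p (c₀ * δ), inner ℝ (S.ι u) (S.ι y) = 0) →
      ∀ t : ℝ, 0 ≤ t → ∃ u' : H, S.ι u' = T t ⟨S.ι u, hu⟩ ∧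
        ‖u'‖ ≤ C₂ * Real.exp (-ks * t) * ‖u‖

/-- `ψ₁(p), …, ψ_n(p)` are slow eigenvectors of `𝕃_p`, orthonormal in `X`. -/
def IsSlowBasis (c₀ δ : ℝ) (ψ : Fin n → Param n → H) : Prop :=
  ∀ p ∈ S.dom, (∀ i, S.IsSlowVector p (c₀ * δ) (ψ i p)) ∧
    Orthonormal ℝ (fun i => S.ι (ψ i p))

/-- (H3): the slow eigenvectors are close to the coordinate tangent vectors of the manifold. -/
def H3 (ψ : Fin n → Param n → H) (C₃ δ : ℝ) : Prop :=
  ∀ p ∈ S.dom, ∀ i, ‖ψ i p - fderiv ℝ S.Φ p (EuclideanSpace.single i 1)‖ ≤ C₃ * δ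

/-- (H4): the slow eigenvectors are uniformly bounded, with their second derivatives in `p`. -/
def H4 (ψ : Fin n → Param n → H) (C₄ : ℝ) : Prop :=
  ∀ p ∈ S.dom, ∀ i, ContDiffAt ℝ 2 (ψ i) p ∧
    ‖ψ i p‖ + ‖iteratedFDeriv ℝ 2 (ψ i) p‖ ≤ C₄

/-- The affine plane `a + X₀`, within `H`. -/
def plane (a : H) : Set H := {u | u - a ∈ S.H₀}

/-- (EH1): the manifold lies in the plane `a + X₀`. -/
def EH1 (a : H) : Prop := ∀ p ∈ S.dom, S.Φ p ∈ S.plane a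

/-- (EA): uniform Gårding type coercivity of the second variation. -/
def EA (γe μe : ℝ) : Prop :=
  ∀ p ∈ S.dom, ∀ v ∈ S.H₀,
    μe * ‖v‖ ^ 2 ≤ S.d2J (S.Φ p) v v + γe * ‖S.ι v‖ ^ 2

/-- The manifold is uniformly embedded: parameters at distance at least `ε` have images at distance
at least `m ε`. -/
def UniformlyEmbedded (m : ℝ → ℝ) : Prop :=
  ∀ ε > 0, ∀ p ∈ S.dom, ∀ q ∈ S.dom, ε ≤ ‖p - q‖ → m ε ≤ ‖S.Φ p - S.Φ q‖

/-- The neighborhood of `Φ(P)` of size `η` in the norm of `H`, within the plane `a + X₀`. -/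
def nbhd (a : H) (P : Set (Param n)) (η : ℝ) : Set H :=
  S.plane a ∩ Metric.thickening η (S.Φ '' P)

/-- `Π_M u = Φ(π u)` is a continuous projection onto the manifold, defined on `N`. -/
def IsProjection (N : Set H) (π : H → Param n) : Prop :=
  MapsTo π N S.dom ∧ ContinuousOn π N ∧ ∀ q ∈ S.dom, S.Φ q ∈ N → π (S.Φ q) = q

/-- The complementary projection `u - Π_M u`. -/
def dev (π : H → Param n) (u : H) : H := u - S.Φ (π u)

/-- (A0): the energy varies by at most `δ₀` on `Φ(P)`. -/
def A0 (P : Set (Param n)) (δ₀ : ℝ) : Prop :=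
  ∀ u₁ ∈ S.Φ '' P, ∀ u₂ ∈ S.Φ '' P, |S.J u₁ - S.J u₂| ≤ δ₀

/-- The estimate of (A1). -/
def A1 (N : Set H) (P : Set (Param n)) (π : H → Param n) (c₁ : ℝ) : Prop :=
  ∀ u ∈ N, ‖S.dev π u‖ ≤ c₁ * Metric.infDist u (S.Φ '' P)

/-- (A2): second order expansion of the energy at the projection, with small residual, normal
coercivity and bounded nonlinearity. -/
def A2 (N : Set H) (π : H → Param n) (δ₂ μ₂ c₂ ϱ : ℝ) : Prop :=
  ∀ u ∈ N,
    |S.dJ (S.Φ (π u)) (S.dev π u)| ≤ δ₂ * ‖S.dev π u‖ ∧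
    μ₂ * ‖S.dev π u‖ ^ 2 ≤ 1 / 2 * S.d2J (S.Φ (π u)) (S.dev π u) (S.dev π u) ∧
    ∃ NE : ℝ, S.J u = S.J (S.Φ (π u)) + S.dJ (S.Φ (π u)) (S.dev π u)
        + 1 / 2 * S.d2J (S.Φ (π u)) (S.dev π u) (S.dev π u) + NE ∧
      |NE| ≤ c₂ * ‖S.dev π u‖ ^ ϱ

/-- The class of gradients: nonnegative self-adjoint operators of `X` with kernel `X₀^⊥`, whose
inverse `X₀ → X₀` is defined on all of `X₀` and bounded. -/
structure IsGradient (G : X →ₗ.[ℝ] X) : Prop where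
  selfAdjoint : IsSelfAdjoint G
  nonneg : ∀ x : G.domain, 0 ≤ inner ℝ (G x) (x : X)
  ker : ∀ x : X, x ∈ S.X₀ᗮ ↔ ∃ h : x ∈ G.domain, G ⟨x, h⟩ = 0
  inv_bounded : ∃ C : ℝ, ∀ y ∈ S.X₀, ∃ x : G.domain, (x : X) ∈ S.X₀ ∧ G x = y ∧ ‖(x : X)‖ ≤ C * ‖y‖

/-- `u` solves `u_t = -G ∇_X J(u)` on `[0, τ)`: it is continuous into `H` on `[0, τ)`, and
differentiable into `H` on `(0, τ)`, where `∇_X J(u)` is in the domain of `G` and the equation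
holds. -/
def IsSolution (G : X →ₗ.[ℝ] X) (τ : ℝ) (u : ℝ → H) : Prop :=
  ContinuousOn u (Ico 0 τ) ∧
  ∀ t ∈ Ioo 0 τ, ∃ (u' : H) (g : G.domain),
    HasDerivAt u u' t ∧ S.IsXGradient (u t) g ∧ S.ι u' = -G g

end Framework

/-- The first time in `[0, τ)` at which `u` is in `N` with parameter `π (u t)` outside `P`; it is
`τ` if there is no such time. -/
def exitTime (N : Set H) (P : Set (Param n)) (π : H → Param n) (τ : ℝ) (u : ℝ → H) : ℝ :=
  sInf (insert τ {t ∈ Ico 0 τ | u t ∈ N ∧ π (u t) ∉ P})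

end Framework

/-- The threshold `η^*`. -/
def etaUp (η c₁ μ₂ c₂ ϱ : ℝ) : ℝ := min η (1 / c₁ * (μ₂ / (2 * c₂)) ^ (1 / (ϱ - 2)))

/-- The radius `η_*`. -/
def etaLow (δ₂ μ₂ δ₀ δ₁ : ℝ) : ℝ :=
  δ₂ / μ₂ + √(δ₂ ^ 2 / μ₂ ^ 2 + 2 * ((δ₀ + δ₁) / μ₂))

end SlowFlow

end

open SlowFlow

/-! The parameter `π u` is the solution near `u` of the `n` equations `⟨ψ_i(p), u - Φ(p)⟩_X = 0`.
Since the tangent vectors of the manifold nearly equal the orthonormal `ψ_i`, the left side has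
`p`-derivative close to minus the identity. Hence `p ↦ p + defect` contracts on balls of a uniform
radius (`norm_add_defect_sub_le`), and the uniform embedding makes its fixed point independent of
the ball (`exists_projection`).

The deviation `w = u - Φ(π u)` is then `X`-orthogonal to the slow eigenspace, where the second
variation is coercive. Indeed `𝕃_p` is symmetric, and for a symmetric semigroup decay at rate `ks`
with any prefactor implies dissipativity with the same rate (`inner_generator_le`). This gives a gap
in the norm of `X` on the domain of `𝕃_p`; it extends by density (`normalSpace_gap`), and the
Gårding inequality lifts it to the norm of `H` (`normalSpace_coercive`). As `C₂` drops out, `μ₂`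
depends only on `ks`, `γe` and `μe`.

The dynamics is an energy barrier. A gradient `G` enters only through its sign, which makes `J`
decrease, and its range in `X₀`, which keeps `u` in the plane. With the expansion of `J` at `Φ(π
u)`, low energy turns distance below `η^*` into distance at most `η_*` (`norm_dev_le_etaLow`). By
continuity the distance cannot cross the gap between them, so the solution can only leave along the
manifold (`stays_near`). -/

noncomputable section

namespace SlowFlow

/-! ### Symmetric strongly continuous semigroups and dissipativity. -/

/-- A strongly continuous semigroup of bounded operators. -/
structure IsC0Semigroup {E : Type*} [NormedAddCommGroup E] [InnerProductSpace ℝ E]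
    (T : ℝ → E →L[ℝ] E) : Prop where
  zero : T 0 = ContinuousLinearMap.id ℝ E
  add : ∀ s t : ℝ, 0 ≤ s → 0 ≤ t → T (s + t) = (T s).comp (T t)
  cont : ∀ x : E, Tendsto (fun t => T t x) (𝓝[>] 0) (𝓝 x)

/-- The pair `(x, f)` belongs to the graph of the generator of `T`. -/
def InGenerator {E : Type*} [NormedAddCommGroup E] [InnerProductSpace ℝ E]
    (T : ℝ → E →L[ℝ] E) (x f : E) : Prop :=
  Tendsto (fun t : ℝ => t⁻¹ • (T t x - x)) (𝓝[>] 0) (𝓝 f)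

namespace IsC0Semigroup

variable {E : Type*} [NormedAddCommGroup E] [InnerProductSpace ℝ E] {T : ℝ → E →L[ℝ] E}

theorem add_apply (hT : IsC0Semigroup T) {s t : ℝ} (hs : 0 ≤ s) (ht : 0 ≤ t) (x : E) :
    T (s + t) x = T s (T t x) := by
  rw [hT.add s t hs ht]; rfl

theorem tendsto_nhdsGE (hT : IsC0Semigroup T) (x : E) :
    Tendsto (fun t => T t x) (𝓝[≥] 0) (𝓝 x) := by
  have h : 𝓝[≥] (0 : ℝ) = pure 0 ⊔ 𝓝[>] 0 := by
    rw [← Ioi_insert, nhdsWithin_insert]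
  rw [h, tendsto_sup]
  refine ⟨?_, hT.cont x⟩
  rw [tendsto_pure_left]
  intro s hs
  simpa [hT.zero] using mem_of_mem_nhds hs

/-- If this failed, the norms would be unbounded along some times `t k → 0`. Every orbit converges
along these times, hence is bounded, which contradicts uniform boundedness. -/
theorem exists_bound_near_zero [CompleteSpace E] (hT : IsC0Semigroup T) :
    ∃ d > 0, ∃ M, ∀ t ∈ Icc 0 d, ‖T t‖ ≤ M := by
  by_contra! hcon
  have h1 : ∀ k : ℕ, ∃ t ∈ Icc (0 : ℝ) (1 / (k + 1)), (k : ℝ) < ‖T t‖ := fun k =>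
    hcon _ (by positivity) k
  choose t ht hk using h1
  have ht0 : Tendsto t atTop (𝓝[≥] 0) := by
    refine tendsto_nhdsWithin_iff.2 ⟨?_, Eventually.of_forall fun k => (ht k).1⟩
    exact squeeze_zero (fun k => (ht k).1) (fun k => (ht k).2) tendsto_one_div_add_atTop_nhds_zero_nat
  obtain ⟨C, hC⟩ := banach_steinhaus (g := fun k => T (t k)) (fun x => by
    obtain ⟨b, hb⟩ := (((hT.tendsto_nhdsGE x).comp ht0).norm).bddAbove_range
    exact ⟨b, fun k => hb ⟨k, rfl⟩⟩)
  obtain ⟨k, hk'⟩ := exists_nat_gt C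
  exact absurd (hC k) (by have := hk k; push Not; linarith)

theorem exists_bound [CompleteSpace E] (hT : IsC0Semigroup T) (t₀ : ℝ) :
    ∃ M, 0 ≤ M ∧ ∀ t ∈ Icc 0 t₀, ‖T t‖ ≤ M := by
  obtain ⟨d, hd, M, hM⟩ := hT.exists_bound_near_zero
  have key : ∀ k : ℕ, ∃ M', ∀ t ∈ Icc 0 (k * d), ‖T t‖ ≤ M' := by
    intro k
    induction k with
    | zero => exact ⟨M, fun t ht => hM t ⟨ht.1, by have := ht.2; simp at this; linarith⟩⟩
    | succ k ih =>
      obtain ⟨M', hM'⟩ := ih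
      refine ⟨max M (M * M'), fun t ht => ?_⟩
      by_cases htd : t ≤ d
      · exact (hM t ⟨ht.1, htd⟩).trans (le_max_left _ _)
      · push Not at htd
        have h2 : t - d ∈ Icc 0 (k * d) :=
          ⟨by linarith, by have := ht.2; push_cast at this; linarith⟩
        have h3 : T t = (T d).comp (T (t - d)) := by
          rw [← hT.add d (t - d) hd.le h2.1]; congr 1; ring
        rw [h3]
        refine (ContinuousLinearMap.opNorm_comp_le _ _).trans (le_max_of_le_right ?_)
        have h4 := hM d ⟨hd.le, le_rfl⟩
        exact mul_le_mul h4 (hM' _ h2) (norm_nonneg _) ((norm_nonneg _).trans h4)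
  obtain ⟨k, hk⟩ := exists_nat_gt (t₀ / d)
  obtain ⟨M', hM'⟩ := key k
  have hk' : t₀ ≤ k * d := ((div_lt_iff₀ hd).1 hk).le
  exact ⟨max M' 0, le_max_right _ _,
    fun t ht => (hM' t ⟨ht.1, ht.2.trans hk'⟩).trans (le_max_left _ _)⟩

/-- Factoring `T t = T (t - h) T h` and using the uniform bound on `[0, t]` avoids continuity of `T`
in operator norm. This serves the left derivative of orbits, with `y` the difference quotient at
`0`. -/
theorem tendsto_sub_apply [CompleteSpace E] (hT : IsC0Semigroup T) {t : ℝ} (ht : 0 < t)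
    {y : ℝ → E} {y₀ : E} (hy : Tendsto y (𝓝[>] 0) (𝓝 y₀)) :
    Tendsto (fun h => T (t - h) (y h)) (𝓝[>] 0) (𝓝 (T t y₀)) := by
  obtain ⟨M, hM0, hM⟩ := hT.exists_bound t
  rw [tendsto_iff_norm_sub_tendsto_zero]
  have h1 : Tendsto (fun h => M * ‖y h - T h y₀‖) (𝓝[>] 0) (𝓝 0) := by
    have := (((hy.sub (hT.cont y₀)).norm).const_mul M)
    simpa using this
  refine squeeze_zero' (Eventually.of_forall fun _ => norm_nonneg _) ?_ h1
  filter_upwards [Ioo_mem_nhdsGT ht] with h hh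
  have h2 : T t y₀ = T (t - h) (T h y₀) := by
    rw [← hT.add_apply (by linarith [hh.2]) hh.1.le]; congr 2; ring
  rw [h2, ← map_sub]
  exact (ContinuousLinearMap.le_opNorm _ _).trans
    (mul_le_mul_of_nonneg_right (hM _ ⟨by linarith [hh.2], by linarith [hh.1]⟩) (norm_nonneg _))

theorem inGenerator_apply (hT : IsC0Semigroup T) {x f : E} (hx : InGenerator T x f) {t : ℝ}
    (ht : 0 ≤ t) : InGenerator T (T t x) (T t f) := by
  refine (((T t).continuous.tendsto f).comp hx).congr' ?_
  filter_upwards [self_mem_nhdsWithin] with h hh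
  simp only [Function.comp_apply, map_smul, map_sub]
  rw [← hT.add_apply ht (le_of_lt hh), ← hT.add_apply (le_of_lt hh) ht, add_comm]

theorem hasDerivWithinAt_Ici (hT : IsC0Semigroup T) {x f : E} (hx : InGenerator T x f) {t : ℝ}
    (ht : 0 ≤ t) : HasDerivWithinAt (fun s => T s x) (T t f) (Ici t) t := by
  rw [← hasDerivWithinAt_Ioi_iff_Ici, hasDerivWithinAt_iff_tendsto_slope' (by simp)]
  have h1 := hT.inGenerator_apply hx ht
  have h2 : Tendsto (fun s => s - t) (𝓝[>] t) (𝓝[>] 0) := by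
    refine tendsto_nhdsWithin_iff.2 ⟨?_, ?_⟩
    · have : Tendsto (fun s => s - t) (𝓝 t) (𝓝 (t - t)) := Continuous.tendsto (by fun_prop) t
      rw [sub_self] at this
      exact this.mono_left nhdsWithin_le_nhds
    · filter_upwards [self_mem_nhdsWithin] with s hs
      exact sub_pos.2 (mem_Ioi.1 hs)
  refine (h1.comp h2).congr' ?_
  filter_upwards [self_mem_nhdsWithin] with s hs
  have hs' : 0 ≤ s - t := (sub_pos.2 hs).le
  simp only [Function.comp_apply, slope_def_module]
  rw [← hT.add_apply hs' ht, sub_add_cancel]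

theorem hasDerivAt [CompleteSpace E] (hT : IsC0Semigroup T) {x f : E} (hx : InGenerator T x f)
    {t : ℝ} (ht : 0 < t) : HasDerivAt (fun s => T s x) (T t f) t := by
  have hr := hT.hasDerivWithinAt_Ici hx ht.le
  have hl : HasDerivWithinAt (fun s => T s x) (T t f) (Iic t) t := by
    rw [← hasDerivWithinAt_Iio_iff_Iic, hasDerivWithinAt_iff_tendsto_slope' (by simp)]
    have h2 : Tendsto (fun s => t - s) (𝓝[<] t) (𝓝[>] 0) := by
      refine tendsto_nhdsWithin_iff.2 ⟨?_, ?_⟩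
      · have : Tendsto (fun s => t - s) (𝓝 t) (𝓝 (t - t)) := Continuous.tendsto (by fun_prop) t
        rw [sub_self] at this
        exact this.mono_left nhdsWithin_le_nhds
      · filter_upwards [self_mem_nhdsWithin] with s hs
        exact sub_pos.2 (mem_Iio.1 hs)
    refine ((hT.tendsto_sub_apply ht hx).comp h2).congr' ?_
    filter_upwards [Ioo_mem_nhdsLT ht] with s hs
    -- The left difference quotient is `T s` applied to the quotient at `0` with increment `t - s`.
    have h3 : T t x = T s (T (t - s) x) := by
      rw [← hT.add_apply hs.1.le (by linarith [hs.2])]; congr 2; ring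
    simp only [Function.comp_apply, slope_def_module, sub_sub_cancel]
    rw [map_smul, map_sub, h3, ← neg_sub t s, inv_neg, neg_smul, ← smul_neg, neg_sub]
  simpa using hl.union hr

/-- If the generator is formally symmetric then so is the semigroup, on its domain. -/
theorem inner_apply_comm [CompleteSpace E] (hT : IsC0Semigroup T)
    (hsymm : ∀ x f y g, InGenerator T x f → InGenerator T y g → inner ℝ f y = inner ℝ x g)
    {x f y g : E} (hx : InGenerator T x f) (hy : InGenerator T y g) {t : ℝ} (ht : 0 ≤ t) :
    inner ℝ (T t x) y = inner ℝ x (T t y) := by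
  have hcont : ∀ {z k : E}, InGenerator T z k → ContinuousOn (fun s => T s z) (Icc 0 t) := by
    intro z k hz s hs
    rcases hs.1.eq_or_lt with h | h
    · subst h
      exact (hT.hasDerivWithinAt_Ici hz le_rfl).continuousWithinAt.mono Icc_subset_Ici_self
    · exact (hT.hasDerivAt hz h).continuousAt.continuousWithinAt
  have hrev : MapsTo (fun s => t - s) (Icc 0 t) (Icc 0 t) := fun s hs =>
    ⟨by linarith [hs.2], by linarith [hs.1]⟩
  -- `s ↦ ⟨T (t - s) x, T s y⟩` has zero right derivative by symmetry of the generator; its values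
  -- at `s = 0` and `s = t` are the two sides.
  have hconst := constant_of_has_deriv_right_zero
    (f := fun s => (inner ℝ (T (t - s) x) (T s y) : ℝ)) (a := 0) (b := t)
    (((hcont hx).comp (by fun_prop) hrev).inner (𝕜 := ℝ) (hcont hy)) (by
      intro s hs
      have h1 : HasDerivAt (fun s => T (t - s) x) (-(T (t - s) f)) s := by
        have := (hT.hasDerivAt hx (sub_pos.2 hs.2)).scomp s ((hasDerivAt_id s).const_sub t)
        simpa [Function.comp_def] using this
      have h2 := h1.hasDerivWithinAt.inner ℝ (s := Ici s) (hT.hasDerivWithinAt_Ici hy hs.1)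
      have h3 := hsymm _ _ _ _ (hT.inGenerator_apply hx (sub_pos.2 hs.2).le)
        (hT.inGenerator_apply hy hs.1)
      rwa [inner_neg_left, h3, add_neg_cancel] at h2)
  have := hconst t ⟨ht, le_rfl⟩
  simpa [hT.zero] using this.symm

/-- A symmetric semigroup that decays along the orbit of `x` is dissipative at `x`, with the same
rate and without the multiplicative constant. -/
theorem inner_generator_le [CompleteSpace E] (hT : IsC0Semigroup T)
    (hsymm : ∀ x f y g, InGenerator T x f → InGenerator T y g → inner ℝ f y = inner ℝ x g)
    {x f : E} (hx : InGenerator T x f) {k C : ℝ}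
    (hdecay : ∀ t, 0 ≤ t → ‖T t x‖ ≤ C * Real.exp (-k * t)) :
    inner ℝ f x ≤ -k * ‖x‖ ^ 2 := by
  rcases eq_or_ne x 0 with rfl | hx0
  · simp
  have hxpos : 0 < ‖x‖ := norm_pos_iff.2 hx0
  -- The orbit norm, rescaled by the expected decay; the claim to reach is `β ≤ 1`.
  set β : ℝ → ℝ := fun t => Real.exp (k * t) * ‖T t x‖ / ‖x‖ with hβ
  have hβ0 : ∀ t, 0 ≤ β t := fun t => by positivity
  have hβC : ∀ t, 0 ≤ t → β t ≤ C / ‖x‖ := fun t ht => by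
    refine div_le_div_of_nonneg_right ?_ hxpos.le
    calc Real.exp (k * t) * ‖T t x‖ ≤ Real.exp (k * t) * (C * Real.exp (-k * t)) :=
          mul_le_mul_of_nonneg_left (hdecay t ht) (Real.exp_pos _).le
      _ = C * (Real.exp (k * t) * Real.exp (-k * t)) := by ring
      _ = C := by rw [← Real.exp_add]; simp
  -- By symmetry `‖T t x‖² = ⟨T (2t) x, x⟩`, then Cauchy–Schwarz.
  have hβ2 : ∀ t, 0 ≤ t → β t ^ 2 ≤ β (2 * t) := fun t ht => by
    have h1 : ‖T t x‖ ^ 2 ≤ ‖T (2 * t) x‖ * ‖x‖ := by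
      rw [← real_inner_self_eq_norm_sq, ← hT.inner_apply_comm hsymm
        (hT.inGenerator_apply hx ht) hx ht, ← hT.add_apply ht ht, two_mul]
      exact real_inner_le_norm _ _
    have h2 : Real.exp (k * (2 * t)) = Real.exp (k * t) ^ 2 := by
      rw [← Real.exp_nat_mul]; congr 1; push_cast; ring
    simp only [hβ]
    rw [h2, div_pow, mul_pow, div_le_div_iff₀ (by positivity) hxpos]
    calc Real.exp (k * t) ^ 2 * ‖T t x‖ ^ 2 * ‖x‖
        ≤ Real.exp (k * t) ^ 2 * (‖T (2 * t) x‖ * ‖x‖) * ‖x‖ := by gcongr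
      _ = _ := by ring
  have hβpow : ∀ j : ℕ, ∀ t, 0 ≤ t → β t ^ 2 ^ j ≤ β (2 ^ j * t) := by
    intro j
    induction j with
    | zero => intro t _; simp
    | succ j ih =>
      intro t ht
      calc β t ^ 2 ^ (j + 1) = (β t ^ 2) ^ 2 ^ j := by rw [← pow_mul]; congr 1; ring
        _ ≤ β (2 * t) ^ 2 ^ j := by gcongr; exact hβ2 t ht
        _ ≤ β (2 ^ j * (2 * t)) := ih _ (by positivity)
        _ = _ := by congr 1; ring
  -- A value above `1` would be squared at each doubling of time and exceed the bound `C / ‖x‖`.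
  -- This is where the prefactor disappears.
  have hβ1 : ∀ t, 0 ≤ t → β t ≤ 1 := by
    intro t ht
    by_contra! hlt
    obtain ⟨j, hj⟩ := pow_unbounded_of_one_lt (C / ‖x‖) hlt
    have h1 : β t ^ j ≤ β t ^ 2 ^ j := pow_le_pow_right₀ hlt.le Nat.lt_two_pow_self.le
    linarith [hβpow j t ht, hβC (2 ^ j * t) (by positivity)]
  have hle : ∀ t, 0 < t →
      inner ℝ (t⁻¹ • (T t x - x)) x ≤ t⁻¹ * (Real.exp (-k * t) - 1) * ‖x‖ ^ 2 := by
    intro t ht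
    have h1 : ‖T t x‖ ≤ Real.exp (-k * t) * ‖x‖ := by
      have := hβ1 t ht.le
      simp only [hβ] at this
      rw [div_le_one hxpos] at this
      calc ‖T t x‖ = Real.exp (-k * t) * (Real.exp (k * t) * ‖T t x‖) := by
            rw [← mul_assoc, ← Real.exp_add]; simp
        _ ≤ _ := by gcongr
    have h2 : inner ℝ (T t x) x ≤ Real.exp (-k * t) * ‖x‖ ^ 2 :=
      (real_inner_le_norm _ _).trans (by nlinarith)
    rw [real_inner_smul_left, inner_sub_left, real_inner_self_eq_norm_sq, mul_assoc]
    gcongr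
    linarith
  -- Both sides of `hle` agree to zeroth order at `t = 0`, so the inequality passes to the
  -- derivatives there.
  have hlim : Tendsto (fun t : ℝ => t⁻¹ * (Real.exp (-k * t) - 1) * ‖x‖ ^ 2) (𝓝[>] 0)
      (𝓝 (-k * ‖x‖ ^ 2)) := by
    have h1 : HasDerivAt (fun t : ℝ => Real.exp (-k * t)) (-k) 0 := by
      have := ((hasDerivAt_id (0 : ℝ)).const_mul (-k)).exp
      simpa using this
    have h2 := h1.hasDerivWithinAt (s := Ioi 0)
    rw [hasDerivWithinAt_iff_tendsto_slope' (by simp)] at h2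
    refine (h2.congr fun t => ?_).mul_const _
    simp [slope_def_field, div_eq_inv_mul]
  refine le_of_tendsto_of_tendsto (Tendsto.inner hx tendsto_const_nhds) hlim ?_
  filter_upwards [self_mem_nhdsWithin] with t ht
  exact hle t ht

end IsC0Semigroup

/-! ### Spectral gap and coercivity on the complement of the slow eigenspace. -/

namespace Framework

variable {n : ℕ} {H X : Type*}
  [NormedAddCommGroup H] [InnerProductSpace ℝ H] [CompleteSpace H]
  [NormedAddCommGroup X] [InnerProductSpace ℝ X] [CompleteSpace X]

variable (S : Framework n H X)

theorem d2J_symm (u v w : H) : S.d2J u v w = S.d2J u w v :=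
  (S.J_smooth.contDiffAt (x := u)).isSymmSndFDerivAt (by simp) v w

theorem isClosed_H₀ : IsClosed (S.H₀ : Set H) :=
  S.X₀_closed.preimage S.ι.continuous

/-- The elements of `H ∩ X₀` that are orthogonal in `X` to `ψ₁, …, ψ_n`. -/
def normalSpace (ψ : Fin n → H) : Submodule ℝ H :=
  S.H₀ ⊓ ⨅ i, (innerSL ℝ (S.ι (ψ i)) ∘L S.ι).ker

theorem mem_normalSpace {ψ : Fin n → H} {w : H} :
    w ∈ S.normalSpace ψ ↔ w ∈ S.H₀ ∧ ∀ i, inner ℝ (S.ι (ψ i)) (S.ι w) = 0 := by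
  simp [normalSpace, Submodule.mem_iInf]

theorem isClosed_normalSpace (ψ : Fin n → H) : IsClosed (S.normalSpace ψ : Set H) := by
  rw [normalSpace, Submodule.coe_inf, Submodule.coe_iInf]
  exact S.isClosed_H₀.inter (isClosed_iInter fun i => ContinuousLinearMap.isClosed_ker _)

/-- The bilinear form `⟨(∇²_X J(u) + γ) v, w⟩_X`. -/
def shiftedForm (u : H) (γ : ℝ) : H →L[ℝ] H →L[ℝ] ℝ :=
  fderiv ℝ (fderiv ℝ S.J) u + γ • (isBoundedBilinearMap_inner (𝕜 := ℝ)).toContinuousLinearMap.bilinearComp S.ι S.ι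

theorem shiftedForm_apply (u : H) (γ : ℝ) (v w : H) :
    S.shiftedForm u γ v w = S.d2J u v w + γ * inner ℝ (S.ι v) (S.ι w) := rfl

theorem shiftedForm_symm (u : H) (γ : ℝ) (v w : H) :
    S.shiftedForm u γ v w = S.shiftedForm u γ w v := by
  rw [shiftedForm_apply, shiftedForm_apply, S.d2J_symm, real_inner_comm]

variable {S}

/-- Symmetry of the second derivative of `J` makes `𝕃_p` formally symmetric, as the semigroup
argument requires. -/
theorem IsLin.inner_comm {p : Param n} {v v' : H} {f f' : X} (h : S.IsLin p v f)
    (h' : S.IsLin p v' f') : inner ℝ f (S.ι v') = inner ℝ (S.ι v) f' := by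
  rw [← h.2.2 v' h'.1, S.d2J_symm, h'.2.2 v h.1, real_inner_comm]

theorem IsSemigroupOf.isC0Semigroup {p : Param n} {T : ℝ → S.X₀ →L[ℝ] S.X₀}
    (hT : S.IsSemigroupOf p T) : IsC0Semigroup T := ⟨hT.zero, hT.add, hT.cont⟩

/-- A dimension count: `X`-orthonormality makes the `n` vectors independent in a space of rank `n`.
Orthogonality to the `ψ i` thus suffices for the decay hypothesis on `Y_p^⊥`. -/
theorem slowSpace_eq_span {p : Param n} {s : ℝ} {ψ : Fin n → H}
    (hrank : Module.rank ℝ (S.slowSpace p s) = n) (hψ : ∀ i, S.IsSlowVector p s (ψ i))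
    (horth : Orthonormal ℝ (fun i => S.ι (ψ i))) :
    S.slowSpace p s = Submodule.span ℝ (range ψ) := by
  have hle : Submodule.span ℝ (range ψ) ≤ S.slowSpace p s :=
    Submodule.span_mono (range_subset_iff.2 hψ)
  have hli : LinearIndependent ℝ ψ :=
    LinearIndependent.of_comp S.ι.toLinearMap horth.linearIndependent
  have hfin : FiniteDimensional ℝ (S.slowSpace p s) := FiniteDimensional.of_rank_eq_nat hrank
  refine (Submodule.eq_of_le_of_finrank_eq hle ?_).symm
  rw [finrank_span_eq_card hli, Module.finrank_eq_of_rank_eq hrank, Fintype.card_fin]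

/-- On the normal space, the spectral gap holds on the domain of the linearization. -/
theorem IsLin.gap {p : Param n} {s ks C₂ : ℝ} {ψ : Fin n → H}
    (hslow : S.slowSpace p s = Submodule.span ℝ (range ψ))
    {T : ℝ → S.X₀ →L[ℝ] S.X₀} (hT : S.IsSemigroupOf p T)
    (hdecay : ∀ u (hu : u ∈ S.H₀), (∀ y ∈ S.slowSpace p s, inner ℝ (S.ι u) (S.ι y) = 0) →
      ∀ t : ℝ, 0 ≤ t → ∃ u' : H, S.ι u' = T t ⟨S.ι u, hu⟩ ∧
        ‖u'‖ ≤ C₂ * Real.exp (-ks * t) * ‖u‖)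
    {v : H} {f : X} (hv : v ∈ S.normalSpace ψ) (hf : S.IsLin p v f) :
    ks * ‖S.ι v‖ ^ 2 ≤ S.d2J (S.Φ p) v v := by
  have : CompleteSpace S.X₀ := S.X₀_closed.completeSpace_coe
  rw [mem_normalSpace] at hv
  have horth : ∀ y ∈ S.slowSpace p s, inner ℝ (S.ι v) (S.ι y) = 0 := by
    intro y hy
    rw [hslow] at hy
    induction hy using Submodule.span_induction with
    | mem y hy => obtain ⟨i, rfl⟩ := hy; rw [real_inner_comm]; exact hv.2 i
    | zero => simp
    | add y z _ _ h1 h2 => rw [map_add, inner_add_right, h1, h2, add_zero]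
    | smul c y _ h1 => rw [map_smul, real_inner_smul_right, h1, mul_zero]
  have hgen : ∀ x f : S.X₀, InGenerator T x f ↔ ∃ v : H, S.ι v = x ∧ S.IsLin p v f := hT.gen
  -- The decay is given in `H` but needed in `X`; the embedding costs only a prefactor, which is
  -- irrelevant.
  have key := hT.isC0Semigroup.inner_generator_le (x := ⟨S.ι v, show S.ι v ∈ S.X₀ from hv.1⟩) (f := ⟨f, hf.2.1⟩)
    (k := ks) (C := ‖S.ι‖ * C₂ * ‖v‖) (by
      intro x f y g hx hy
      obtain ⟨v₁, h1, h1'⟩ := (hgen _ _).1 hx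
      obtain ⟨v₂, h2, h2'⟩ := (hgen _ _).1 hy
      have := h1'.inner_comm h2'
      rwa [h1, h2] at this)
    ((hgen _ _).2 ⟨v, rfl, hf⟩) (by
      intro t ht
      obtain ⟨u', h1, h2⟩ := hdecay v hv.1 horth t ht
      calc ‖T t ⟨S.ι v, hv.1⟩‖ = ‖S.ι u'‖ := by rw [h1]; rfl
        _ ≤ ‖S.ι‖ * ‖u'‖ := S.ι.le_opNorm _
        _ ≤ ‖S.ι‖ * (C₂ * Real.exp (-ks * t) * ‖v‖) := by gcongr
        _ = _ := by ring)
  have h3 : inner ℝ f (S.ι v) ≤ -ks * ‖S.ι v‖ ^ 2 := key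
  have h4 := hf.2.2 v hv.1
  linarith

/-- The domain of the linearization is dense in the normal space, so the spectral gap extends. -/
theorem normalSpace_gap {p : Param n} {s ks C₂ γ μ : ℝ} {ψ : Fin n → H} (hμ : 0 < μ)
    (hψ : ∀ i, S.IsSlowVector p s (ψ i)) (horth : Orthonormal ℝ (fun i => S.ι (ψ i)))
    (hslow : S.slowSpace p s = Submodule.span ℝ (range ψ))
    (hEA : ∀ v ∈ S.H₀, μ * ‖v‖ ^ 2 ≤ S.d2J (S.Φ p) v v + γ * ‖S.ι v‖ ^ 2)
    {T : ℝ → S.X₀ →L[ℝ] S.X₀} (hT : S.IsSemigroupOf p T)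
    (hdecay : ∀ u (hu : u ∈ S.H₀), (∀ y ∈ S.slowSpace p s, inner ℝ (S.ι u) (S.ι y) = 0) →
      ∀ t : ℝ, 0 ≤ t → ∃ u' : H, S.ι u' = T t ⟨S.ι u, hu⟩ ∧
        ‖u'‖ ≤ C₂ * Real.exp (-ks * t) * ‖u‖)
    {w : H} (hw : w ∈ S.normalSpace ψ) :
    ks * ‖S.ι w‖ ^ 2 ≤ S.d2J (S.Φ p) w w := by
  set W := S.normalSpace ψ with hW
  have : CompleteSpace W := (S.isClosed_normalSpace ψ).completeSpace_coe
  have hmem : ∀ {w}, w ∈ W ↔ w ∈ S.H₀ ∧ ∀ i, inner ℝ (S.ι (ψ i)) (S.ι w) = 0 :=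
    S.mem_normalSpace
  set B := S.shiftedForm (S.Φ p) γ with hB
  set A : W →L[ℝ] W →L[ℝ] ℝ := B.bilinearComp W.subtypeL W.subtypeL with hA
  have hAapp : ∀ v w : W, A v w = B v w := fun _ _ => rfl
  have hcoer : IsCoercive A := by
    refine ⟨μ, hμ, fun v => ?_⟩
    have := hEA v (hmem.1 v.2).1
    rw [hAapp, hB, shiftedForm_apply, real_inner_self_eq_norm_sq]
    calc μ * ‖v‖ * ‖v‖ = μ * ‖(v : H)‖ ^ 2 := by rw [Submodule.coe_norm]; ring
      _ ≤ _ := this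
  -- Lax–Milgram on the normal space, with the form made coercive by the Gårding shift.
  set L := hcoer.continuousLinearEquivOfBilin with hL
  have hLapp : ∀ v w : W, inner ℝ (L v) w = A v w :=
    hcoer.continuousLinearEquivOfBilin_apply
  have hLsymm : ∀ y w : W, A (L.symm y) w = inner ℝ y w := fun y w => by
    rw [← hLapp, ContinuousLinearEquiv.apply_symm_apply]
  -- the solution operator of `(∇²_X J + γ) R v = v` in the normal space
  set I : W →L[ℝ] X := S.ι ∘L W.subtypeL with hI
  set R : W → W := fun v => L.symm (ContinuousLinearMap.adjoint I (I v)) with hR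
  have hRapp : ∀ v w : W, A (R v) w = inner ℝ (S.ι v) (S.ι w) := fun v w => by
    rw [hR, hLsymm, ContinuousLinearMap.adjoint_inner_left]; rfl
  -- The weak equation is known only for test vectors in `W`. A general `w ∈ H₀` splits off its
  -- `X`-projection `z` onto the span of the `ψ i`; the terms with `z` vanish because the `ψ i` are
  -- eigenvectors orthogonal to `W`.
  have hRlin : ∀ v : W, S.IsLin p (R v) (γ • S.ι (R v) - S.ι v) := by
    intro v
    refine ⟨(hmem.1 (R v).2).1, ?_, fun w hw => ?_⟩
    · exact S.X₀.sub_mem (S.X₀.smul_mem _ (hmem.1 (R v).2).1) (hmem.1 v.2).1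
    set z : H := ∑ i, (inner ℝ (S.ι (ψ i)) (S.ι w) : ℝ) • ψ i with hz
    have hzH : z ∈ S.H₀ := Submodule.sum_mem _ fun i _ =>
      S.H₀.smul_mem _ (by obtain ⟨_, _, h⟩ := hψ i; exact h.1)
    have hwz : w - z ∈ W := by
      refine hmem.2 ⟨S.H₀.sub_mem hw hzH, fun i => ?_⟩
      have : S.ι z = ∑ i, (inner ℝ (S.ι (ψ i)) (S.ι w) : ℝ) • S.ι (ψ i) := by
        simp [hz]
      rw [map_sub, inner_sub_right, this, horth.inner_right_fintype, sub_self]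
    have hperp : ∀ v : W, inner ℝ (S.ι v) (S.ι z) = 0 := by
      intro v
      simp only [hz, map_sum, map_smul, inner_sum, real_inner_smul_right]
      refine Finset.sum_eq_zero fun i _ => ?_
      rw [real_inner_comm (S.ι (ψ i)) (S.ι v), (hmem.1 v.2).2 i, mul_zero]
    have hd2 : ∀ v : W, S.d2J (S.Φ p) v z = 0 := by
      intro v
      have h1 : S.d2J (S.Φ p) v z
          = ∑ i, (inner ℝ (S.ι (ψ i)) (S.ι w) : ℝ) * S.d2J (S.Φ p) v (ψ i) := by
        simp [d2J, hz]
      rw [h1]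
      refine Finset.sum_eq_zero fun i _ => ?_
      obtain ⟨lam, _, h2⟩ := hψ i
      have h3 := h2.2.2 v (hmem.1 v.2).1
      rw [real_inner_smul_left, (hmem.1 v.2).2 i, mul_zero] at h3
      rw [S.d2J_symm]
      linear_combination (-(inner ℝ (S.ι (ψ i)) (S.ι w) : ℝ)) * h3
    have h1 := hRapp v ⟨w - z, hwz⟩
    rw [hAapp, hB, shiftedForm_apply] at h1
    have h2 : S.d2J (S.Φ p) (R v) (w - z) = S.d2J (S.Φ p) (R v) w := by
      have h3 : S.d2J (S.Φ p) (R v) (w - z)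
        = S.d2J (S.Φ p) (R v) w - S.d2J (S.Φ p) (R v) z := by simp [d2J]
      rw [h3, hd2, sub_zero]
    simp only [map_sub, inner_sub_right, hperp, sub_zero] at h1
    rw [h2] at h1
    rw [inner_sub_left, real_inner_smul_left]
    linarith
  have hdense : Dense (Submodule.span ℝ (range R) : Set W) := by
    rw [Submodule.dense_iff_topologicalClosure_eq_top, Submodule.topologicalClosure_eq_top_iff,
      Submodule.eq_bot_iff]
    intro y hy
    -- Orthogonality of `y` is tested on `R (L⁻¹ y)`: symmetry of the form turns this product into
    -- `‖ι (L⁻¹ y)‖²`.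
    have h1 : inner ℝ (R (L.symm y)) y = 0 := hy _ (Submodule.subset_span ⟨_, rfl⟩)
    have h2 : inner ℝ (S.ι (L.symm y)) (S.ι (L.symm y)) = 0 := by
      rw [← hRapp, hAapp, hB, S.shiftedForm_symm, ← hB, ← hAapp, hLsymm, real_inner_comm, h1]
    have h3 : ((L.symm y : W) : H) = 0 := by
      apply S.ι_injective
      rw [map_zero]
      exact inner_self_eq_zero.1 h2
    have h4 : L.symm y = 0 := Subtype.ext h3
    simpa using h4
  have hlin : ∀ v ∈ Submodule.span ℝ (range R), ∃ f, S.IsLin p (v : W) f := by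
    intro v hv
    induction hv using Submodule.span_induction with
    | mem v hv => obtain ⟨x, rfl⟩ := hv; exact ⟨_, hRlin x⟩
    | zero => exact ⟨0, S.H₀.zero_mem, S.X₀.zero_mem, fun w _ => by simp [d2J]⟩
    | add v w _ _ h1 h2 =>
      obtain ⟨f, hf⟩ := h1
      obtain ⟨g, hg⟩ := h2
      refine ⟨f + g, S.H₀.add_mem hf.1 hg.1, S.X₀.add_mem hf.2.1 hg.2.1, fun w hw => ?_⟩
      rw [inner_add_left, ← hf.2.2 w hw, ← hg.2.2 w hw]
      simp [d2J]; ring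
    | smul c v _ h1 =>
      obtain ⟨f, hf⟩ := h1
      refine ⟨c • f, S.H₀.smul_mem _ hf.1, S.X₀.smul_mem _ hf.2.1, fun w hw => ?_⟩
      rw [real_inner_smul_left, ← hf.2.2 w hw]
      simp [d2J]
  -- Both sides are continuous in the norm of `H`, so the inequality passes to the closure.
  have hclosed : IsClosed {v : W | ks * ‖S.ι v‖ ^ 2 ≤ S.d2J (S.Φ p) v v} := by
    refine isClosed_le (by fun_prop) ?_
    unfold d2J
    fun_prop
  exact hclosed.closure_subset_iff.2
    (fun v (hv : v ∈ Submodule.span ℝ (range R)) => by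
      obtain ⟨f, hf⟩ := hlin v hv
      exact IsLin.gap hslow hT hdecay v.2 hf) (hdense ⟨w, hw⟩)

/-- The second variation is coercive on the normal space, in the norm of `H`. -/
theorem normalSpace_coercive {c₀ δ ks C₂ γe μe : ℝ} {ψ : Fin n → Param n → H} (hks : 0 < ks)
    (hγe : 0 < γe) (hμe : 0 < μe) (h1 : S.H1 ks c₀ δ) (h2 : S.H2 ks c₀ δ C₂)
    (hψ : S.IsSlowBasis c₀ δ ψ) (hEA : S.EA γe μe) {p : Param n} (hp : p ∈ S.dom) {w : H}
    (hw : w ∈ S.H₀) (hperp : ∀ i, inner ℝ (S.ι (ψ i p)) (S.ι w) = 0) :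
    μe * ks / (2 * (ks + γe)) * ‖w‖ ^ 2 ≤ 1 / 2 * S.d2J (S.Φ p) w w := by
  obtain ⟨T, hT, hdecay⟩ := h2 p hp
  have hgap := normalSpace_gap hμe (hψ p hp).1 (hψ p hp).2
    (slowSpace_eq_span (h1 p hp).2 (hψ p hp).1 (hψ p hp).2) (hEA p hp) hT hdecay
    (S.mem_normalSpace.2 ⟨hw, hperp⟩)
  have hea := hEA p hp w hw
  rw [div_mul_eq_mul_div, div_le_iff₀ (by positivity)]
  -- `ks` times the Gårding inequality plus `γe` times the gap cancels the `X`-norm and leaves `(ks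
  -- + γe)` times the second variation.
  nlinarith [mul_le_mul_of_nonneg_left hea hks.le, mul_le_mul_of_nonneg_left hgap hγe.le]

end Framework

/-! ### Derivative interpolation, and a projection built by contraction. -/

/-- Interpolation: a bound on a map and its second derivative bounds the first derivative. -/
theorem norm_fderiv_le_of_norm_iteratedFDeriv_two_le {E F : Type*} [NormedAddCommGroup E]
    [NormedSpace ℝ E] [NormedAddCommGroup F] [NormedSpace ℝ F] {f : E → F} {p : E} {h C : ℝ}
    (hh : 0 < h) (hf : ∀ x ∈ Metric.closedBall p h, ContDiffAt ℝ 2 f x)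
    (h0 : ∀ x ∈ Metric.closedBall p h, ‖f x‖ ≤ C)
    (h2 : ∀ x ∈ Metric.closedBall p h, ‖iteratedFDeriv ℝ 2 f x‖ ≤ C) :
    ‖fderiv ℝ f p‖ ≤ (2 * C + C * h ^ 2) / h := by
  have hp : p ∈ Metric.closedBall p h := Metric.mem_closedBall_self hh.le
  have hC : 0 ≤ C := (norm_nonneg _).trans (h0 p hp)
  have hconv := convex_closedBall p h
  have hlip : ∀ x ∈ Metric.closedBall p h, ‖fderiv ℝ f x - fderiv ℝ f p‖ ≤ C * h := by
    intro x hx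
    have h3 := hconv.norm_image_sub_le_of_norm_fderiv_le (𝕜 := ℝ) (f := fderiv ℝ f) (C := C)
      (fun y hy => ((hf y hy).fderiv_right (m := 1) (by norm_num)).differentiableAt (by simp))
      (fun y hy => by
        rw [← norm_iteratedFDeriv_one, norm_iteratedFDeriv_fderiv]
        exact h2 y hy) hp hx
    refine h3.trans (mul_le_mul_of_nonneg_left ?_ hC)
    rwa [← dist_eq_norm]
  have hstep : ∀ v : E, ‖v‖ = h → ‖fderiv ℝ f p v‖ ≤ 2 * C + C * h ^ 2 := by
    intro v hv
    have hx : p + v ∈ Metric.closedBall p h := by simp [hv]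
    have h3 := hconv.norm_image_sub_le_of_norm_fderiv_le' (𝕜 := ℝ) (f := f)
      (fun y hy => (hf y hy).differentiableAt (by simp)) hlip hp hx
    rw [add_sub_cancel_left, hv] at h3
    calc ‖fderiv ℝ f p v‖ = ‖f (p + v) - f p - (f (p + v) - f p - fderiv ℝ f p v)‖ := by
          congr 1; abel
      _ ≤ ‖f (p + v) - f p‖ + ‖f (p + v) - f p - fderiv ℝ f p v‖ := norm_sub_le _ _
      _ ≤ (‖f (p + v)‖ + ‖f p‖) + C * h * h := add_le_add (norm_sub_le _ _) h3
      _ ≤ (C + C) + C * h * h := by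
          gcongr
          · exact h0 _ hx
          · exact h0 _ hp
      _ = _ := by ring
  refine ContinuousLinearMap.opNorm_le_bound _ (by positivity) fun v => ?_
  rcases eq_or_ne v 0 with rfl | hv0
  · simp
  have hv : 0 < ‖v‖ := norm_pos_iff.2 hv0
  -- Rescaling to length `h` keeps the increment inside the ball where the bounds hold.
  have h3 := hstep ((h / ‖v‖) • v) (by
    rw [norm_smul, Real.norm_of_nonneg (by positivity)]; field_simp)
  rw [map_smul, norm_smul, Real.norm_of_nonneg (by positivity), div_mul_eq_mul_div,
    div_le_iff₀ hv] at h3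
  rw [div_mul_eq_mul_div, le_div_iff₀ hh]
  linarith

/-- A parametrized family of equations `g u p = 0`, for which `p ↦ p + g u p` contracts on balls,
is uniquely solved by a continuous projection onto the manifold. -/
theorem exists_projection {E H : Type*} [NormedAddCommGroup E] [CompleteSpace E]
    [NormedAddCommGroup H] {P dom : Set E} {Φ : E → H} {g : H → E → E} {η ρ₁ M : ℝ}
    (hη : 0 < η) (hρ₁ : 0 < ρ₁) (hM : 0 ≤ M) (hMη : 2 * M * η ≤ ρ₁ / 2)
    (hdom : ∀ q ∈ P, Metric.closedBall q ρ₁ ⊆ dom)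
    (hcontr : ∀ q ∈ P, ∀ u, ‖u - Φ q‖ < η → ∀ p ∈ Metric.closedBall q ρ₁,
      ∀ p' ∈ Metric.closedBall q ρ₁, ‖(p + g u p) - (p' + g u p')‖ ≤ 1 / 2 * ‖p - p'‖)
    (hlip : ∀ p ∈ dom, ∀ u u', ‖g u p - g u' p‖ ≤ M * ‖u - u'‖)
    (hzero : ∀ p, g (Φ p) p = 0)
    (hsep : ∀ p ∈ dom, ∀ q ∈ dom, ρ₁ / 2 ≤ ‖p - q‖ → 2 * η ≤ ‖Φ p - Φ q‖) :
    ∃ π : H → E, ContinuousOn π (Metric.thickening η (Φ '' P)) ∧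
      (∀ q ∈ dom, Φ q ∈ Metric.thickening η (Φ '' P) → π (Φ q) = q) ∧
      ∀ u, ∀ q ∈ P, ‖u - Φ q‖ < η →
        π u ∈ Metric.closedBall q ρ₁ ∧ g u (π u) = 0 ∧ ‖π u - q‖ ≤ 2 * M * ‖u - Φ q‖ := by
  have hthick : ∀ u ∈ Metric.thickening η (Φ '' P), ∃ q ∈ P, ‖u - Φ q‖ < η := by
    intro u hu
    obtain ⟨_, ⟨q, hq, rfl⟩, h⟩ := Metric.mem_thickening_iff.1 hu
    exact ⟨q, hq, by rwa [← dist_eq_norm]⟩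
  have hself : ∀ q ∈ P, q ∈ Metric.closedBall q ρ₁ := fun q _ =>
    Metric.mem_closedBall_self hρ₁.le
  -- A perturbation of the identity by a `1/2`-contraction is injective with a quantitative inverse;
  -- uniqueness, the location of zeros and continuity of `π` all rest on this.
  have hinj : ∀ q ∈ P, ∀ u, ‖u - Φ q‖ < η → ∀ p ∈ Metric.closedBall q ρ₁,
      ∀ p' ∈ Metric.closedBall q ρ₁, ‖p - p'‖ ≤ 2 * ‖g u p - g u p'‖ := by
    intro q hq u hu p hp p' hp'
    have h1 := hcontr q hq u hu p hp p' hp'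
    have h2 : ‖p - p'‖ ≤ ‖(p + g u p) - (p' + g u p')‖ + ‖g u p - g u p'‖ := by
      refine le_trans (le_of_eq ?_) (norm_sub_le _ _)
      congr 1; abel
    linarith
  have hnear : ∀ q ∈ P, ∀ u, ‖u - Φ q‖ < η → ∀ p ∈ Metric.closedBall q ρ₁, g u p = 0 →
      ‖p - q‖ ≤ 2 * M * ‖u - Φ q‖ := by
    intro q hq u hu p hp hp0
    have h1 := hinj q hq u hu p hp q (hself q hq)
    have h2 := hlip q (hdom q hq (hself q hq)) (Φ q) u
    rw [hzero, norm_sub_rev (Φ q)] at h2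
    rw [hp0] at h1
    linarith
  have hex : ∀ q ∈ P, ∀ u, ‖u - Φ q‖ < η → ∃ p ∈ Metric.closedBall q ρ₁, g u p = 0 := by
    intro q hq u hu
    have hmaps : MapsTo (fun p => p + g u p) (Metric.closedBall q ρ₁)
        (Metric.closedBall q ρ₁) := by
      intro p hp
      have h1 := hcontr q hq u hu p hp q (hself q hq)
      have h2 := hlip q (hdom q hq (hself q hq)) u (Φ q)
      rw [hzero, sub_zero] at h2
      rw [mem_closedBall_iff_norm] at hp ⊢
      have h3 : ‖p + g u p - q‖ ≤ ‖(p + g u p) - (q + g u q)‖ + ‖g u q‖ := by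
        refine le_trans (le_of_eq ?_) (norm_add_le _ _)
        congr 1; abel
      have h4 : M * ‖u - Φ q‖ ≤ M * η := mul_le_mul_of_nonneg_left hu.le hM
      linarith
    have hK : ContractingWith (1 / 2) (hmaps.restrict _ _ _) := by
      refine ⟨by norm_num, LipschitzWith.of_dist_le_mul fun p p' => ?_⟩
      have := hcontr q hq u hu p p.2 p' p'.2
      rw [Subtype.dist_eq, Subtype.dist_eq, dist_eq_norm, dist_eq_norm]
      simpa using this
    obtain ⟨p, hp, hfix, -⟩ := hK.exists_fixedPoint' Metric.isClosed_closedBall.isComplete hmaps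
      (hself q hq) (edist_ne_top _ _)
    exact ⟨p, hp, by simpa [Function.IsFixedPt] using hfix⟩
  classical
  -- The zero is picked with an arbitrary admissible center `q`; independence of that center is
  -- proved in `hspec`.
  set π : H → E := fun u => if h : ∃ p, ∃ q ∈ P, ‖u - Φ q‖ < η ∧ p ∈ Metric.closedBall q ρ₁ ∧
    g u p = 0 then h.choose else 0 with hπ
  have hspec : ∀ u, ∀ q ∈ P, ‖u - Φ q‖ < η →
      π u ∈ Metric.closedBall q ρ₁ ∧ g u (π u) = 0 := by
    intro u q hq hu
    obtain ⟨p, hp, hp0⟩ := hex q hq u hu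
    have h : ∃ p, ∃ q ∈ P, ‖u - Φ q‖ < η ∧ p ∈ Metric.closedBall q ρ₁ ∧ g u p = 0 :=
      ⟨p, q, hq, hu, hp, hp0⟩
    obtain ⟨q', hq', hu', hc, hc0⟩ := h.choose_spec
    have hπu : π u = h.choose := dif_pos h
    rw [hπu]
    refine ⟨?_, hc0⟩
    have h1 := hnear q' hq' u hu' _ hc hc0
    -- Both `Φ q'` and `Φ q` are within `η` of `u`, so separation brings the two centers together.
    -- With `‖h.choose - q'‖ ≤ 2 * M * η ≤ ρ₁ / 2` the zero lies in the ball of either.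
    have h2 : ‖q' - q‖ < ρ₁ / 2 := by
      by_contra! hcon
      have h3 := hsep q' (hdom q' hq' (hself q' hq')) q (hdom q hq (hself q hq)) hcon
      have h4 : ‖Φ q' - Φ q‖ ≤ ‖u - Φ q‖ + ‖u - Φ q'‖ := by
        refine le_trans (le_of_eq ?_) (norm_sub_le _ _)
        congr 1; abel
      linarith
    rw [mem_closedBall_iff_norm]
    have h3 : ‖h.choose - q‖ ≤ ‖h.choose - q'‖ + ‖q' - q‖ := norm_sub_le_norm_sub_add_norm_sub _ _ _
    have h4 : 2 * M * ‖u - Φ q'‖ ≤ 2 * M * η := mul_le_mul_of_nonneg_left hu'.le (by positivity)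
    linarith
  refine ⟨π, ?_, ?_, fun u q hq hu => ⟨(hspec u q hq hu).1, (hspec u q hq hu).2,
    hnear q hq u hu _ (hspec u q hq hu).1 (hspec u q hq hu).2⟩⟩
  · intro u hu
    obtain ⟨q, hq, huq⟩ := hthick u hu
    refine ContinuousAt.continuousWithinAt ?_
    have hev : ∀ᶠ u' in 𝓝 u, ‖u' - Φ q‖ < η :=
      (Continuous.tendsto (by fun_prop : Continuous fun u' : H => ‖u' - Φ q‖) u).eventually_lt_const
        huq
    rw [ContinuousAt, tendsto_iff_norm_sub_tendsto_zero]
    have hlim : Tendsto (fun u' => 2 * (M * ‖u' - u‖)) (𝓝 u) (𝓝 0) := by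
      have := Continuous.tendsto (by fun_prop : Continuous fun u' : H => 2 * (M * ‖u' - u‖)) u
      simpa using this
    refine squeeze_zero' (Eventually.of_forall fun _ => norm_nonneg _) ?_ hlim
    filter_upwards [hev] with u' hu'
    obtain ⟨h1, h1'⟩ := hspec u' q hq hu'
    obtain ⟨h2, h2'⟩ := hspec u q hq huq
    have h3 := hinj q hq u' hu' _ h1 _ h2
    have h4 := hlip (π u) (hdom q hq h2) u' u
    rw [h1', zero_sub, norm_neg] at h3
    rw [h2', sub_zero] at h4
    linarith
  · intro p hp hmem
    obtain ⟨q, hq, hpq⟩ := hthick _ hmem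
    obtain ⟨h1, h1'⟩ := hspec (Φ p) q hq hpq
    have h2 : p ∈ Metric.closedBall q ρ₁ := by
      rw [mem_closedBall_iff_norm]
      by_contra! hcon
      have := hsep p hp q (hdom q hq (hself q hq)) (by linarith)
      linarith
    have h3 := hinj q hq (Φ p) hpq _ h1 _ h2
    rw [h1', hzero, sub_zero, norm_zero, mul_zero] at h3
    exact sub_eq_zero.1 (norm_le_zero_iff.1 h3)

/-! ### Energy estimates at a point of the manifold. -/

namespace Framework

variable {n : ℕ} {H X : Type*}
  [NormedAddCommGroup H] [InnerProductSpace ℝ H] [CompleteSpace H]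
  [NormedAddCommGroup X] [InnerProductSpace ℝ X] [CompleteSpace X]

variable {S : Framework n H X}

theorem norm_ι_le {Cι : ℝ} (hι : ‖S.ι‖ ≤ Cι) (v : H) : ‖S.ι v‖ ≤ Cι * ‖v‖ :=
  (S.ι.le_opNorm v).trans (mul_le_mul_of_nonneg_right hι (norm_nonneg _))

theorem abs_inner_ι_le {Cι : ℝ} (hι : ‖S.ι‖ ≤ Cι) (v w : H) :
    |inner ℝ (S.ι v) (S.ι w)| ≤ Cι ^ 2 * ‖v‖ * ‖w‖ := by
  have hC : 0 ≤ Cι := (norm_nonneg _).trans hι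
  calc |inner ℝ (S.ι v) (S.ι w)| ≤ ‖S.ι v‖ * ‖S.ι w‖ := abs_real_inner_le_norm _ _
    _ ≤ (Cι * ‖v‖) * (Cι * ‖w‖) := by
        gcongr <;> exact norm_ι_le hι _
    _ = _ := by ring

/-- On `H₀` the first variation is the `X`-product with minus the residual, whose `H`-norm is
`O(δ)`. -/
theorem abs_dJ_le {Cι C₀ δ : ℝ} (hι : ‖S.ι‖ ≤ Cι) (h0 : S.H0 C₀ δ) {p : Param n}
    (hp : p ∈ S.dom) {w : H} (hw : w ∈ S.H₀) :
    |S.dJ (S.Φ p) w| ≤ Cι ^ 2 * C₀ * δ * ‖w‖ := by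
  obtain ⟨R, hR, hRb⟩ := h0 p hp
  rw [← abs_neg, hR.2 w hw]
  calc _ ≤ Cι ^ 2 * ‖R‖ * ‖w‖ := abs_inner_ι_le hι _ _
    _ ≤ Cι ^ 2 * (C₀ * δ) * ‖w‖ := by gcongr
    _ = _ := by ring

/-- Second order expansion of the energy at a point of the manifold. -/
theorem abs_energy_remainder_le {Cι εS CS r : ℝ} (hι : ‖S.ι‖ ≤ Cι) (hCS : 0 ≤ CS) (hr : 1 < r)
    (hN : S.NonlinearBound εS CS r) {p : Param n} (hp : p ∈ S.dom) {v : H} (hv : v ∈ S.H₀)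
    (hvε : ‖v‖ ≤ εS) :
    |S.J (S.Φ p + v) - S.J (S.Φ p) - S.dJ (S.Φ p) v - 1 / 2 * S.d2J (S.Φ p) v v|
      ≤ Cι ^ 2 * CS * ‖v‖ ^ (r + 1) := by
  have hJ : Differentiable ℝ S.J := S.J_smooth.differentiable (by simp)
  -- With the quadratic Taylor polynomial removed along the segment, the derivative is exactly `-⟨N,
  -- v⟩`, with `N` the remainder at `s • v`. So `J` needs no third derivative, and the order is `r +
  -- 1 > 2`.
  set f : ℝ → ℝ := fun s => S.J (S.Φ p + s • v) - s * S.dJ (S.Φ p) v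
    - s ^ 2 / 2 * S.d2J (S.Φ p) v v with hf
  have hderiv : ∀ s, HasDerivAt f (S.dJ (S.Φ p + s • v) v - S.dJ (S.Φ p) v
      - s * S.d2J (S.Φ p) v v) s := by
    intro s
    have h1 : HasDerivAt (fun s : ℝ => S.Φ p + s • v) v s := by
      simpa using ((hasDerivAt_id s).smul_const v).const_add (S.Φ p)
    have h2 := (hJ (S.Φ p + s • v)).hasFDerivAt.comp_hasDerivAt s h1
    have h3 := (hasDerivAt_id s).mul_const (S.dJ (S.Φ p) v)
    have h4 := (((hasDerivAt_id s).pow 2).div_const 2).mul_const (S.d2J (S.Φ p) v v)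
    refine ((h2.sub h3).sub h4).congr_deriv ?_
    simp [dJ]
  have hbound : ∀ s ∈ Ico (0 : ℝ) 1, ‖S.dJ (S.Φ p + s • v) v - S.dJ (S.Φ p) v
      - s * S.d2J (S.Φ p) v v‖ ≤ Cι ^ 2 * CS * ‖v‖ ^ (r + 1) := by
    intro s hs
    have hle : ‖s • v‖ ≤ ‖v‖ := by
      rw [norm_smul, Real.norm_of_nonneg hs.1]
      exact mul_le_of_le_one_left (norm_nonneg _) hs.2.le
    obtain ⟨N, hN1, hN2⟩ := hN p hp (s • v) (S.H₀.smul_mem s hv) (hle.trans hvε)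
    have h1 := hN1.2 v hv
    have h2 : S.d2J (S.Φ p) (s • v) v = s * S.d2J (S.Φ p) v v := by simp [d2J]
    have h3 : S.dJ (S.Φ p + s • v) v - S.dJ (S.Φ p) v - s * S.d2J (S.Φ p) v v
        = -inner ℝ (S.ι N) (S.ι v) := by rw [h2] at h1; linarith
    rw [h3, norm_neg, Real.norm_eq_abs]
    calc _ ≤ Cι ^ 2 * ‖N‖ * ‖v‖ := abs_inner_ι_le hι _ _
      _ ≤ Cι ^ 2 * (CS * ‖v‖ ^ r) * ‖v‖ := by
          gcongr
          exact hN2.trans (mul_le_mul_of_nonneg_left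
            (Real.rpow_le_rpow (norm_nonneg _) hle (by linarith)) hCS)
      _ = _ := by rw [Real.rpow_add_one' (norm_nonneg _) (by linarith)]; ring
  have := norm_image_sub_le_of_norm_deriv_le_segment_01'
    (fun s _ => (hderiv s).hasDerivWithinAt) hbound
  rw [Real.norm_eq_abs] at this
  convert this using 2
  simp [hf]; ring

end Framework

/-! ### The defect map and its contraction estimate. -/

theorem norm_le_card_mul {n : ℕ} {x : Param n} {C : ℝ} (hx : ∀ i, |x i| ≤ C) :
    ‖x‖ ≤ n * C := by
  calc ‖x‖ = ‖∑ i, EuclideanSpace.single i (x i)‖ := by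
        congr 1
        ext j
        simp [Finset.sum_apply, Pi.single_apply]
    _ ≤ ∑ i, ‖EuclideanSpace.single i (x i)‖ := norm_sum_le _ _
    _ ≤ ∑ _i : Fin n, C := Finset.sum_le_sum fun i _ => by simpa using hx i
    _ = n * C := by simp

theorem map_eq_sum_coord {n : ℕ} {F : Type*} [NormedAddCommGroup F] [NormedSpace ℝ F]
    (A : Param n →L[ℝ] F) (v : Param n) :
    A v = ∑ i, v i • A (EuclideanSpace.single i 1) := by
  have h : v = ∑ i, v i • EuclideanSpace.single i (1 : ℝ) := by
    ext j
    simp [Finset.sum_apply, Pi.single_apply]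
  conv_lhs => rw [h]
  simp

namespace Framework

variable {n : ℕ} {H X : Type*}
  [NormedAddCommGroup H] [InnerProductSpace ℝ H] [CompleteSpace H]
  [NormedAddCommGroup X] [InnerProductSpace ℝ X] [CompleteSpace X]

variable (S : Framework n H X)

/-- The components of `u - Φ(p)` along the slow eigenvectors at `p`. -/
def defect (ψ : Fin n → Param n → H) (u : H) (p : Param n) : Param n :=
  WithLp.toLp 2 fun i => inner ℝ (S.ι (ψ i p)) (S.ι (u - S.Φ p))

variable {S}

@[simp]
theorem defect_apply (ψ : Fin n → Param n → H) (u : H) (p : Param n) (i : Fin n) :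
    S.defect ψ u p i = inner ℝ (S.ι (ψ i p)) (S.ι (u - S.Φ p)) := rfl

theorem defect_self (ψ : Fin n → Param n → H) (p : Param n) : S.defect ψ (S.Φ p) p = 0 := by
  ext i
  simp

theorem norm_defect_sub_le {Cι : ℝ} {ψ : Fin n → Param n → H} (hι : ‖S.ι‖ ≤ Cι) {p : Param n}
    (hψ : Orthonormal ℝ (fun i => S.ι (ψ i p))) (u u' : H) :
    ‖S.defect ψ u p - S.defect ψ u' p‖ ≤ n * Cι * ‖u - u'‖ := by
  rw [mul_assoc]
  refine norm_le_card_mul fun i => ?_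
  have h1 : (S.defect ψ u p - S.defect ψ u' p) i
      = inner ℝ (S.ι (ψ i p)) (S.ι (u - u')) := by
    rw [PiLp.sub_apply, defect_apply, defect_apply, ← inner_sub_right, ← map_sub]
    congr 2; abel
  rw [h1]
  calc _ ≤ ‖S.ι (ψ i p)‖ * ‖S.ι (u - u')‖ := abs_real_inner_le_norm _ _
    _ = ‖S.ι (u - u')‖ := by rw [hψ.1 i, one_mul]
    _ ≤ _ := norm_ι_le hι _

theorem norm_fderiv_Φ_le {ψ : Fin n → Param n → H} {C₃ C₄ δ : ℝ} (hC₃ : 0 ≤ C₃) (hC₄ : 0 ≤ C₄)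
    (hδ : δ ≤ 1)
    (h3 : S.H3 ψ C₃ δ) (h4 : S.H4 ψ C₄) {p : Param n} (hp : p ∈ S.dom) :
    ‖fderiv ℝ S.Φ p‖ ≤ (n + 1) * (C₃ + C₄) := by
  have hi : ∀ i, ‖fderiv ℝ S.Φ p (EuclideanSpace.single i 1)‖ ≤ C₃ + C₄ := by
    intro i
    have h1 := h3 p hp i
    have h2 := (h4 p hp i).2
    have h5 := norm_sub_norm_le (fderiv ℝ S.Φ p (EuclideanSpace.single i 1)) (ψ i p)
    rw [norm_sub_rev] at h5
    have h6 : C₃ * δ ≤ C₃ := mul_le_of_le_one_right hC₃ hδ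
    have := norm_nonneg (iteratedFDeriv ℝ 2 (ψ i) p)
    linarith
  refine ContinuousLinearMap.opNorm_le_bound _ (by positivity) fun v => ?_
  rw [map_eq_sum_coord]
  calc _ ≤ ∑ i, ‖v i • fderiv ℝ S.Φ p (EuclideanSpace.single i 1)‖ := norm_sum_le _ _
    _ ≤ ∑ _i : Fin n, ‖v‖ * (C₃ + C₄) := Finset.sum_le_sum fun i _ => by
        rw [norm_smul]
        exact mul_le_mul (PiLp.norm_apply_le v i) (hi i) (norm_nonneg _) (norm_nonneg _)
    _ = n * (C₃ + C₄) * ‖v‖ := by simp; ring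
    _ ≤ _ := by
        gcongr
        linarith

/-- On a small ball, `p ↦ p + defect` is a contraction. -/
theorem norm_add_defect_sub_le {Cι C₃ δ D Λ η ρ₁ : ℝ} {ψ : Fin n → Param n → H}
    (hι : ‖S.ι‖ ≤ Cι) {q : Param n} (hρ₁ : 0 ≤ ρ₁) (hdom : Metric.closedBall q ρ₁ ⊆ S.dom)
    (horth : ∀ p ∈ S.dom, Orthonormal ℝ (fun i => S.ι (ψ i p))) (h3 : S.H3 ψ C₃ δ)
    (hψ : ∀ p ∈ S.dom, ∀ i, DifferentiableAt ℝ (ψ i) p)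
    (hD : ∀ p ∈ Metric.closedBall q ρ₁, ∀ i, ‖fderiv ℝ (ψ i) p‖ ≤ D)
    (hΛ : ∀ p ∈ Metric.closedBall q ρ₁, ‖fderiv ℝ S.Φ p‖ ≤ Λ)
    {u : H} (hu : ‖u - S.Φ q‖ ≤ η) {p p' : Param n} (hp : p ∈ Metric.closedBall q ρ₁)
    (hp' : p' ∈ Metric.closedBall q ρ₁) :
    ‖(p + S.defect ψ u p) - (p' + S.defect ψ u p')‖
      ≤ n * (n * (Cι * (C₃ * δ)) + Cι ^ 2 * D * (η + Λ * ρ₁)) * ‖p - p'‖ := by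
  have hCι : 0 ≤ Cι := (norm_nonneg _).trans hι
  have hconv := convex_closedBall q ρ₁
  have hq : q ∈ Metric.closedBall q ρ₁ := Metric.mem_closedBall_self hρ₁
  have hΛ0 : 0 ≤ Λ := (norm_nonneg _).trans (hΛ q hq)
  have hΦd : ∀ p ∈ Metric.closedBall q ρ₁, DifferentiableAt ℝ S.Φ p := fun p hp =>
    (S.Φ_smooth p (hdom hp)).differentiableAt (by simp)
  have hdist : ∀ p ∈ Metric.closedBall q ρ₁, ‖u - S.Φ p‖ ≤ η + Λ * ρ₁ := by
    intro p hp
    have h1 := hconv.norm_image_sub_le_of_norm_fderiv_le hΦd hΛ hp hq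
    have h2 : ‖q - p‖ ≤ ρ₁ := by
      rw [norm_sub_rev]; exact mem_closedBall_iff_norm.1 hp
    calc ‖u - S.Φ p‖ ≤ ‖u - S.Φ q‖ + ‖S.Φ q - S.Φ p‖ := norm_sub_le_norm_sub_add_norm_sub _ _ _
      _ ≤ η + Λ * ρ₁ := add_le_add hu (h1.trans (mul_le_mul_of_nonneg_left h2 hΛ0))
  rw [mul_assoc]
  refine norm_le_card_mul fun i => ?_
  set f : Param n → ℝ := fun p => p i + inner ℝ (S.ι (ψ i p)) (S.ι (u - S.Φ p)) with hf
  set f' : Param n → Param n →L[ℝ] ℝ := fun p => EuclideanSpace.proj i +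
    (fderivInnerCLM ℝ (S.ι (ψ i p), S.ι (u - S.Φ p))).comp
      ((S.ι ∘L fderiv ℝ (ψ i) p).prod (S.ι ∘L (-fderiv ℝ S.Φ p))) with hf'
  have hder : ∀ p ∈ Metric.closedBall q ρ₁, HasFDerivAt f (f' p) p := by
    intro p hp
    have h1 : HasFDerivAt (fun p => S.ι (ψ i p)) (S.ι ∘L fderiv ℝ (ψ i) p) p :=
      S.ι.hasFDerivAt.comp p (hψ p (hdom hp) i).hasFDerivAt
    have h2 : HasFDerivAt (fun p => S.ι (u - S.Φ p)) (S.ι ∘L (-fderiv ℝ S.Φ p)) p :=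
      S.ι.hasFDerivAt.comp p ((hΦd p hp).hasFDerivAt.const_sub u)
    exact (EuclideanSpace.proj (𝕜 := ℝ) i).hasFDerivAt.add (h1.inner ℝ h2)
  have hf'v : ∀ p v, f' p v = v i - inner ℝ (S.ι (ψ i p)) (S.ι (fderiv ℝ S.Φ p v))
      + inner ℝ (S.ι (fderiv ℝ (ψ i) p v)) (S.ι (u - S.Φ p)) := by
    intro p v
    simp [hf', fderivInnerCLM_apply]
    ring
  have hbound : ∀ p ∈ Metric.closedBall q ρ₁,
      ‖f' p‖ ≤ n * (Cι * (C₃ * δ)) + Cι ^ 2 * D * (η + Λ * ρ₁) := by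
    intro p hp
    have hD0 : 0 ≤ D := (norm_nonneg _).trans (hD p hp i)
    have hη0 : 0 ≤ η := (norm_nonneg _).trans hu
    have hδ0 : 0 ≤ C₃ * δ := (norm_nonneg _).trans (h3 p (hdom hp) i)
    refine ContinuousLinearMap.opNorm_le_bound _ (by positivity) fun v => ?_
    rw [hf'v]
    -- Orthonormality expands `v i` as `∑ j, v j ⟨ψ i, ψ j⟩`, so the identity cancels against the
    -- tangent map up to the `O(δ)` mismatch of (H3).
    have h1 : v i - inner ℝ (S.ι (ψ i p)) (S.ι (fderiv ℝ S.Φ p v)) =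
        ∑ j, v j * inner ℝ (S.ι (ψ i p))
          (S.ι (ψ j p - fderiv ℝ S.Φ p (EuclideanSpace.single j 1))) := by
      simp only [map_sub, inner_sub_right, mul_sub, Finset.sum_sub_distrib]
      congr 1
      · have := orthonormal_iff_ite.1 (horth p (hdom hp)) i
        simp [this]
      · rw [map_eq_sum_coord]
        simp [inner_sum, real_inner_smul_right]
    have h2 : |v i - inner ℝ (S.ι (ψ i p)) (S.ι (fderiv ℝ S.Φ p v))|
        ≤ n * (Cι * (C₃ * δ)) * ‖v‖ := by
      rw [h1]
      calc _ ≤ ∑ j, |v j * inner ℝ (S.ι (ψ i p))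
              (S.ι (ψ j p - fderiv ℝ S.Φ p (EuclideanSpace.single j 1)))| :=
            Finset.abs_sum_le_sum_abs _ _
        _ ≤ ∑ _j : Fin n, ‖v‖ * (Cι * (C₃ * δ)) := Finset.sum_le_sum fun j _ => by
            rw [abs_mul]
            refine mul_le_mul (PiLp.norm_apply_le v j) ?_ (abs_nonneg _) (norm_nonneg _)
            calc _ ≤ ‖S.ι (ψ i p)‖ * ‖S.ι (ψ j p - fderiv ℝ S.Φ p (EuclideanSpace.single j 1))‖ :=
                  abs_real_inner_le_norm _ _
              _ ≤ 1 * (Cι * (C₃ * δ)) := by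
                  rw [(horth p (hdom hp)).1 i]
                  gcongr
                  exact (norm_ι_le hι _).trans (mul_le_mul_of_nonneg_left (h3 p (hdom hp) j) hCι)
              _ = _ := one_mul _
        _ = _ := by simp; ring
    -- The rotation of the eigenvectors is multiplied by `u - Φ(p)`, which is small on a small ball.
    have h5 : |inner ℝ (S.ι (fderiv ℝ (ψ i) p v)) (S.ι (u - S.Φ p))|
        ≤ Cι ^ 2 * D * (η + Λ * ρ₁) * ‖v‖ := by
      calc _ ≤ Cι ^ 2 * ‖fderiv ℝ (ψ i) p v‖ * ‖u - S.Φ p‖ := abs_inner_ι_le hι _ _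
        _ ≤ Cι ^ 2 * (D * ‖v‖) * (η + Λ * ρ₁) := by
            gcongr
            · exact (ContinuousLinearMap.le_opNorm _ _).trans
                (mul_le_mul_of_nonneg_right (hD p hp i) (norm_nonneg _))
            · exact hdist p hp
        _ = _ := by ring
    rw [Real.norm_eq_abs, add_mul]
    exact (abs_add_le _ _).trans (add_le_add h2 h5)
  have := hconv.norm_image_sub_le_of_norm_hasFDerivWithin_le
    (fun p hp => (hder p hp).hasFDerivWithinAt) hbound hp' hp
  simpa [hf, Real.norm_eq_abs] using this

end Framework

/-! ### The energy barrier and invariance under gradient flows. -/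

/-- Completing the square: `etaLow` is the larger root of the quadratic. -/
theorem le_etaLow {x μ δ₀ δ₁ δ₂ : ℝ} (hμ : 0 < μ)
    (h : μ / 2 * x ^ 2 - δ₂ * x ≤ δ₀ + δ₁) : x ≤ etaLow δ₂ μ δ₀ δ₁ := by
  have h1 : (x - δ₂ / μ) ^ 2 ≤ δ₂ ^ 2 / μ ^ 2 + 2 * ((δ₀ + δ₁) / μ) := by
    have h2 : (x - δ₂ / μ) ^ 2
        = 2 / μ * (μ / 2 * x ^ 2 - δ₂ * x) + δ₂ ^ 2 / μ ^ 2 := by field_simp; ring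
    have h3 : 2 * ((δ₀ + δ₁) / μ) = 2 / μ * (δ₀ + δ₁) := by ring
    rw [h2, h3, add_comm]
    gcongr
  have h4 := Real.abs_le_sqrt h1
  unfold etaLow
  linarith [le_abs_self (x - δ₂ / μ)]

/-- Below this threshold, the one in `etaUp`, half of the coercive term absorbs the superquadratic
remainder. -/
theorem mul_rpow_le_of_lt {x μ c ϱ : ℝ} (hx : 0 ≤ x) (hμ : 0 < μ) (hc : 0 < c) (hϱ : 2 < ϱ)
    (h : x ≤ (μ / (2 * c)) ^ (1 / (ϱ - 2))) : c * x ^ ϱ ≤ μ / 2 * x ^ 2 := by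
  have h1 : x ^ ϱ = x ^ (ϱ - 2) * x ^ 2 := by
    rw [← Real.rpow_natCast, ← Real.rpow_add' hx (by push_cast; linarith)]
    congr 1; push_cast; ring
  have h2 : x ^ (ϱ - 2) ≤ μ / (2 * c) := by
    refine (Real.rpow_le_rpow hx h (by linarith)).trans (le_of_eq ?_)
    rw [← Real.rpow_mul (by positivity), one_div_mul_cancel (by linarith), Real.rpow_one]
  rw [h1]
  calc c * (x ^ (ϱ - 2) * x ^ 2) ≤ c * (μ / (2 * c) * x ^ 2) := by gcongr
    _ = _ := by field_simp

namespace Framework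

variable {n : ℕ} {H X : Type*}
  [NormedAddCommGroup H] [InnerProductSpace ℝ H] [CompleteSpace H]
  [NormedAddCommGroup X] [InnerProductSpace ℝ X] [CompleteSpace X]

variable {S : Framework n H X}

theorem mem_nbhd_iff {a : H} {P : Set (Param n)} {η : ℝ} (hP : P.Nonempty) {u : H} :
    u ∈ S.nbhd a P η ↔ u ∈ S.plane a ∧ Metric.infDist u (S.Φ '' P) < η := by
  rw [nbhd, mem_inter_iff, Metric.mem_thickening_iff_infDist_lt (hP.image _)]

/-- The values of a gradient operator are in `X₀`. -/
theorem IsGradient.apply_mem {G : X →ₗ.[ℝ] X} (hG : S.IsGradient G) (g : G.domain) :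
    G g ∈ S.X₀ := by
  have : CompleteSpace S.X₀ := S.X₀_closed.completeSpace_coe
  rw [← S.X₀.orthogonal_orthogonal, Submodule.mem_orthogonal]
  intro x hx
  obtain ⟨hxd, hx0⟩ := (hG.ker x).1 hx
  have h1 := LinearPMap.adjoint_isFormalAdjoint hG.selfAdjoint.dense_domain
  rw [LinearPMap.isSelfAdjoint_def.1 hG.selfAdjoint] at h1
  have h2 := h1 ⟨x, hxd⟩ g
  rw [hx0, inner_zero_left] at h2
  exact h2.symm

/-- Products with vectors of `X₀ᗮ` are conserved because `G` takes values in `X₀`, and the closed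
`X₀` is its own double complement. The mean value theorem needs only continuity at time `0`. -/
theorem IsSolution.mem_plane {G : X →ₗ.[ℝ] X} (hG : S.IsGradient G) {τ : ℝ} {u : ℝ → H}
    (hu : S.IsSolution G τ u) {a : H} (h0 : u 0 ∈ S.plane a) {t : ℝ} (ht : t ∈ Ico 0 τ) :
    u t ∈ S.plane a := by
  have : CompleteSpace S.X₀ := S.X₀_closed.completeSpace_coe
  rcases ht.1.eq_or_lt with h | htpos
  · rwa [← h]
  have key : S.ι (u t - u 0) ∈ S.X₀ := by
    rw [← S.X₀.orthogonal_orthogonal, Submodule.mem_orthogonal]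
    intro x hx
    have hcont : ContinuousOn (fun s => inner ℝ x (S.ι (u s))) (Icc 0 t) := by
      have := hu.1.mono (Icc_subset_Ico_right ht.2)
      exact continuousOn_const.inner (S.ι.continuous.comp_continuousOn this)
    obtain ⟨c, -, hc⟩ := exists_hasDerivAt_eq_slope (fun s => inner ℝ x (S.ι (u s)))
      (fun _ => 0) htpos hcont (by
        intro s hs
        obtain ⟨u', g, hd, -, hg⟩ := hu.2 s ⟨hs.1, hs.2.trans ht.2⟩
        have h1 : HasDerivAt (fun s => S.ι (u s)) (S.ι u') s := S.ι.hasFDerivAt.comp_hasDerivAt s hd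
        have h2 := (hasDerivAt_const s x).inner ℝ h1
        have h3 : inner ℝ x (G g) = 0 := by
          rw [real_inner_comm]
          exact (Submodule.mem_orthogonal _ _).1 hx _ (hG.apply_mem g)
        simpa [hg, h3] using h2)
    have h1 : inner ℝ x (S.ι (u t)) - inner ℝ x (S.ι (u 0)) = 0 := by
      have := hc.symm
      rw [sub_zero, div_eq_zero_iff] at this
      exact this.resolve_right htpos.ne'
    rwa [map_sub, inner_sub_right]
  have h1 : u t - a = (u t - u 0) + (u 0 - a) := by abel
  change u t - a ∈ S.H₀
  rw [h1]
  exact S.H₀.add_mem key h0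

/-- Along the flow the derivative of `J` is `-⟨g, G g⟩`, with `g` the variational derivative. -/
theorem IsSolution.energy_antitoneOn {G : X →ₗ.[ℝ] X} (hG : S.IsGradient G) {τ : ℝ} {u : ℝ → H}
    (hu : S.IsSolution G τ u) : AntitoneOn (fun t => S.J (u t)) (Ico 0 τ) := by
  have hder : ∀ t ∈ Ioo 0 τ, ∃ e ≤ 0, HasDerivAt (fun t => S.J (u t)) e t := by
    intro t ht
    obtain ⟨u', g, hd, hgrad, hg⟩ := hu.2 t ht
    refine ⟨_, ?_, ((S.J_smooth.differentiable (by simp)) (u t)).hasFDerivAt.comp_hasDerivAt t hd⟩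
    have h1 : fderiv ℝ S.J (u t) u' = inner ℝ (g : X) (S.ι u') := hgrad u'
    rw [h1, hg, inner_neg_right, real_inner_comm]
    exact neg_nonpos.2 (hG.nonneg g)
  refine antitoneOn_of_deriv_nonpos (convex_Ico 0 τ)
    (S.J_smooth.continuous.comp_continuousOn hu.1) ?_ ?_
  · rw [interior_Ico]
    intro t ht
    obtain ⟨e, -, he⟩ := hder t ht
    exact he.differentiableAt.differentiableWithinAt
  · rw [interior_Ico]
    intro t ht
    obtain ⟨e, he0, he⟩ := hder t ht
    rwa [he.deriv]

/-- An energy estimate: points near the manifold with low energy are very near the manifold. -/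
theorem norm_dev_le_etaLow {P : Set (Param n)} {π : H → Param n} {a : H}
    {η c₁ δ₀ δ₁ δ₂ μ₂ c₂ ϱ : ℝ} (hc₁ : 0 < c₁) (hμ₂ : 0 < μ₂) (hc₂ : 0 < c₂) (hϱ : 2 < ϱ)
    (hA0 : S.A0 P δ₀) (hA1 : S.A1 (S.nbhd a P η) P π c₁)
    (hA2 : S.A2 (S.nbhd a P η) π δ₂ μ₂ c₂ ϱ) {u : H} (hu : u ∈ S.nbhd a P η) (hπ : π u ∈ P)
    (hdist : Metric.infDist u (S.Φ '' P) < etaUp η c₁ μ₂ c₂ ϱ)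
    (hJ : S.J u ≤ sSup (S.J '' (S.Φ '' P)) + δ₁) :
    ‖S.dev π u‖ ≤ etaLow δ₂ μ₂ δ₀ δ₁ := by
  obtain ⟨hr, hco, NE, hexp, hNE⟩ := hA2 u hu
  have hmem : S.Φ (π u) ∈ S.Φ '' P := mem_image_of_mem _ hπ
  -- Since `π u ∈ P`, the base point competes in (A0), so the initial energy excess over it is at
  -- most `δ₀ + δ₁`.
  have hsup : sSup (S.J '' (S.Φ '' P)) ≤ S.J (S.Φ (π u)) + δ₀ := by
    refine csSup_le ⟨_, mem_image_of_mem _ hmem⟩ ?_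
    rintro _ ⟨v, hv, rfl⟩
    linarith [(abs_le.1 (hA0 v hv _ hmem)).2]
  have hsmall : ‖S.dev π u‖ ≤ (μ₂ / (2 * c₂)) ^ (1 / (ϱ - 2)) := by
    have h1 := hdist.trans_le (min_le_right _ _)
    calc ‖S.dev π u‖ ≤ c₁ * Metric.infDist u (S.Φ '' P) := hA1 u hu
      _ ≤ c₁ * (1 / c₁ * (μ₂ / (2 * c₂)) ^ (1 / (ϱ - 2))) := by gcongr
      _ = _ := by field_simp
  have hnl := mul_rpow_le_of_lt (norm_nonneg _) hμ₂ hc₂ hϱ hsmall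
  refine le_etaLow hμ₂ ?_
  have h1 := (abs_le.1 hr).1
  have h2 := (abs_le.1 hNE).1
  linarith

/-- Solutions that start near the manifold stay near it until they exit along it. -/
theorem IsSolution.stays_near {P : Set (Param n)} {π : H → Param n} {a : H}
    {η c₁ δ₀ δ₁ δ₂ μ₂ c₂ ϱ : ℝ} (hc₁ : 0 < c₁) (hμ₂ : 0 < μ₂) (hc₂ : 0 < c₂) (hϱ : 2 < ϱ)
    (hcont : ContinuousOn π (S.nbhd a P η)) (hA0 : S.A0 P δ₀)
    (hA1 : S.A1 (S.nbhd a P η) P π c₁) (hA2 : S.A2 (S.nbhd a P η) π δ₂ μ₂ c₂ ϱ)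
    (hlt : etaLow δ₂ μ₂ δ₀ δ₁ < etaUp η c₁ μ₂ c₂ ϱ) {G : X →ₗ.[ℝ] X} (hG : S.IsGradient G)
    {τ : ℝ} {u : ℝ → H} (hτ : 0 < τ) (hu : S.IsSolution G τ u)
    (hu0 : u 0 ∈ S.nbhd a P (etaUp η c₁ μ₂ c₂ ϱ))
    (hJ0 : S.J (u 0) ≤ sSup (S.J '' (S.Φ '' P)) + δ₁) :
    ContinuousOn (fun t => π (u t)) (Ico 0 (exitTime (S.nbhd a P η) P π τ u)) ∧
      ∀ t ∈ Ico 0 (exitTime (S.nbhd a P η) P π τ u),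
        u t ∈ S.nbhd a P η ∧ π (u t) ∈ P ∧ ‖u t - S.Φ (π (u t))‖ ≤ etaLow δ₂ μ₂ δ₀ δ₁ := by
  have hP : P.Nonempty := by
    obtain ⟨_, ⟨q, hq, -⟩, -⟩ := Metric.mem_thickening_iff.1 hu0.2
    exact ⟨q, hq⟩
  have hbdd : BddBelow (insert τ {t ∈ Ico 0 τ | u t ∈ S.nbhd a P η ∧ π (u t) ∉ P}) := by
    refine ⟨0, ?_⟩
    rintro s (rfl | hs)
    · exact hτ.le
    · exact hs.1.1
  set T := exitTime (S.nbhd a P η) P π τ u with hT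
  have hTτ : T ≤ τ := csInf_le hbdd (mem_insert _ _)
  have hsub : Ico 0 T ⊆ Ico 0 τ := Ico_subset_Ico_right hTτ
  have hπP : ∀ t ∈ Ico 0 T, u t ∈ S.nbhd a P η → π (u t) ∈ P := by
    intro t ht hN
    by_contra hcon
    exact absurd (csInf_le hbdd (mem_insert_of_mem _ ⟨hsub ht, hN, hcon⟩)) (not_le.2 ht.2)
  set d : ℝ → ℝ := fun t => Metric.infDist (u t) (S.Φ '' P) with hd
  have hdcont : ContinuousOn d (Ico 0 T) :=
    (Metric.continuous_infDist_pt _).comp_continuousOn (hu.1.mono hsub)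
  have hplane : ∀ t ∈ Ico 0 T, u t ∈ S.plane a := fun t ht =>
    hu.mem_plane hG hu0.1 (hsub ht)
  have hkey : ∀ t ∈ Ico 0 T, d t < etaUp η c₁ μ₂ c₂ ϱ →
      u t ∈ S.nbhd a P η ∧ π (u t) ∈ P ∧ ‖u t - S.Φ (π (u t))‖ ≤ etaLow δ₂ μ₂ δ₀ δ₁ := by
    intro t ht hdt
    have hN : u t ∈ S.nbhd a P η :=
      (mem_nbhd_iff hP).2 ⟨hplane t ht, hdt.trans_le (min_le_left _ _)⟩
    refine ⟨hN, hπP t ht hN, ?_⟩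
    exact norm_dev_le_etaLow hc₁ hμ₂ hc₂ hϱ hA0 hA1 hA2 hN (hπP t ht hN) hdt
      ((hu.energy_antitoneOn hG ⟨le_rfl, hτ⟩ (hsub ht) ht.1).trans hJ0)
  -- As `π (u t) ∈ P`, the distance is bounded by the deviation; this creates the forbidden gap.
  have hkey' : ∀ t ∈ Ico 0 T, d t < etaUp η c₁ μ₂ c₂ ϱ → d t ≤ etaLow δ₂ μ₂ δ₀ δ₁ := by
    intro t ht hdt
    obtain ⟨-, h1, h2⟩ := hkey t ht hdt
    refine le_trans ?_ h2
    rw [← dist_eq_norm]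
    exact Metric.infDist_le_dist_of_mem (mem_image_of_mem _ h1)
  have hall : ∀ t ∈ Ico 0 T, d t < etaUp η c₁ μ₂ c₂ ϱ := by
    intro t ht
    by_contra! hcon
    have h0 : (0 : ℝ) ∈ Ico 0 T := ⟨le_rfl, ht.1.trans_lt ht.2⟩
    have hd0 := hkey' 0 h0 ((mem_nbhd_iff hP).1 hu0).2
    -- The midpoint of the gap would be attained, but values below `etaUp` are at most `etaLow`.
    obtain ⟨s, hs, hds⟩ := intermediate_value_Icc ht.1
      (hdcont.mono (Icc_subset_Ico_right ht.2))
      (show (etaLow δ₂ μ₂ δ₀ δ₁ + etaUp η c₁ μ₂ c₂ ϱ) / 2 ∈ Icc (d 0) (d t) from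
        ⟨by linarith, by linarith⟩)
    have := hkey' s ⟨hs.1, hs.2.trans_lt ht.2⟩ (by linarith)
    linarith
  refine ⟨?_, fun t ht => hkey t ht (hall t ht)⟩
  exact hcont.comp (hu.1.mono hsub) fun t ht => (hkey t ht (hall t ht)).1

end Framework

end SlowFlow

end

/-! ### Choice of the constants and conclusion. -/

open SlowFlow
theorem theoremt
    -- the dimension of the manifold and the constants of the hypotheses
    (n : ℕ) (Cι εS CS r C₀ ks c₀ C₂ C₃ C₄ γe μe ρ : ℝ) (m : ℝ → ℝ)
    (hCι : 0 < Cι) (hεS : 0 < εS) (hCS : 0 < CS) (hr : 1 < r) (hC₀ : 0 < C₀) (hks : 0 < ks)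
    (hc₀ : 0 < c₀) (hC₂ : 0 < C₂) (hC₃ : 0 < C₃) (hC₄ : 0 < C₄) (hγe : 0 < γe) (hμe : 0 < μe)
    (hρ : 0 < ρ) (hm : ∀ ε > 0, 0 < m ε) :
    ∃ δmax η c₁ K μ₂ c₂ ϱ : ℝ, 0 < δmax ∧ 0 < η ∧ 0 < c₁ ∧ 0 < K ∧ 0 < μ₂ ∧ 0 < c₂ ∧ 2 < ϱ ∧
      ∀ (H : Type*) (X : Type*)
        [NormedAddCommGroup H] [InnerProductSpace ℝ H] [CompleteSpace H]
        [NormedAddCommGroup X] [InnerProductSpace ℝ X] [CompleteSpace X]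
        (S : Framework n H X) (P : Set (Param n)) (ψ : Fin n → Param n → H) (a : H) (δ : ℝ),
        0 < δ → δ ≤ δmax →
        ‖S.ι‖ ≤ Cι → S.UniformlyEmbedded m →
        -- the hypotheses hold on a set that contains the `ρ`-neighborhood of `P`
        (∀ p ∈ P, Metric.ball p ρ ⊆ S.dom) →
        S.NonlinearBound εS CS r →
        S.H0 C₀ δ → S.H1 ks c₀ δ → S.H2 ks c₀ δ C₂ →
        S.IsSlowBasis c₀ δ ψ → S.H3 ψ C₃ δ → S.H4 ψ C₄ →
        S.EH1 a → S.EA γe μe →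
        ∃ π : H → Param n,
          -- (A1) and (A2)
          S.IsProjection (S.nbhd a P η) π ∧
          S.A1 (S.nbhd a P η) P π c₁ ∧
          S.A2 (S.nbhd a P η) π (K * δ) μ₂ c₂ ϱ ∧
          -- the flow of every gradient in the class
          ∀ δ₀ δ₁ : ℝ, 0 < δ₀ → 0 < δ₁ → S.A0 P δ₀ →
            etaLow (K * δ) μ₂ δ₀ δ₁ < etaUp η c₁ μ₂ c₂ ϱ →
            ∀ (G : X →ₗ.[ℝ] X), S.IsGradient G →
              ∀ (τ : ℝ) (u : ℝ → H), 0 < τ → S.IsSolution G τ u →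
                u 0 ∈ S.nbhd a P (etaUp η c₁ μ₂ c₂ ϱ) →
                S.J (u 0) ≤ sSup (S.J '' (S.Φ '' P)) + δ₁ →
                ContinuousOn (fun t => π (u t)) (Ico 0 (exitTime (S.nbhd a P η) P π τ u)) ∧
                ∀ t ∈ Ico 0 (exitTime (S.nbhd a P η) P π τ u),
                  u t ∈ S.nbhd a P η ∧ π (u t) ∈ P ∧
                  ‖u t - S.Φ (π (u t))‖ ≤ etaLow (K * δ) μ₂ δ₀ δ₁ := by
  -- `n + 1` in place of `n` keeps the denominators positive when `n = 0`.
  set N : ℝ := (n : ℝ) + 1 with hN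
  have hN0 : 0 < N := by positivity
  have hnN : (n : ℝ) ≤ N := by rw [hN]; linarith
  -- Interpolation balls of radius `ρ / 2` about points within `ρ₁ ≤ ρ / 4` of `P` stay in the
  -- `ρ`-balls.
  set h : ℝ := ρ / 2 with hh
  have hh0 : 0 < h := by positivity
  set D : ℝ := (2 * C₄ + C₄ * h ^ 2) / h with hD
  have hD0 : 0 < D := by positivity
  set Λ : ℝ := N * (C₃ + C₄) with hΛ
  have hΛ0 : 0 < Λ := by positivity
  set M : ℝ := N * Cι with hM
  have hM0 : 0 < M := by positivity
  set c₁ : ℝ := 1 + Λ * (2 * M) with hc₁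
  have hc₁0 : 0 < c₁ := by positivity
  set ρ₁ : ℝ := min (ρ / 4) (1 / (8 * N * Cι ^ 2 * D * Λ)) with hρ₁
  have hρ₁0 : 0 < ρ₁ := by positivity
  have hρ₁ρ : ρ₁ ≤ ρ / 4 := min_le_left _ _
  have hρ₁Λ : ρ₁ * (8 * N * Cι ^ 2 * D * Λ) ≤ 1 :=
    (le_div_iff₀ (by positivity)).1 (min_le_right _ _)
  have hmρ := hm (ρ₁ / 2) (by positivity)
  -- The four bounds serve, in order: contraction, mapping the ball into itself and locating the
  -- zero, separation of parameters, and `‖w‖ ≤ εS`.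
  set η : ℝ := min (min (1 / (8 * N * Cι ^ 2 * D)) (ρ₁ / (4 * M)))
    (min (m (ρ₁ / 2) / 2) (εS / c₁)) with hη
  have hη0 : 0 < η := by positivity
  have hη1 : η * (8 * N * Cι ^ 2 * D) ≤ 1 :=
    (le_div_iff₀ (by positivity)).1 ((min_le_left _ _).trans (min_le_left _ _))
  have hη2 : η * (4 * M) ≤ ρ₁ :=
    (le_div_iff₀ (by positivity)).1 ((min_le_left _ _).trans (min_le_right _ _))
  have hη3 : η * 2 ≤ m (ρ₁ / 2) :=
    (le_div_iff₀ (by positivity)).1 ((min_le_right _ _).trans (min_le_left _ _))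
  have hη4 : η * c₁ ≤ εS :=
    (le_div_iff₀ (by positivity)).1 ((min_le_right _ _).trans (min_le_right _ _))
  refine ⟨min 1 (1 / (8 * N ^ 2 * Cι * C₃)), η, c₁, Cι ^ 2 * C₀, μe * ks / (2 * (ks + γe)),
    Cι ^ 2 * CS, r + 1, by positivity, hη0, hc₁0, by positivity, by positivity, by positivity,
    by linarith, ?_⟩
  intro H X _ _ _ _ _ _ S P ψ a δ hδ0 hδ hι hemb hdom hNL h0 h1 h2 hψ h3 h4 hE hEA
  have hδ1 : δ ≤ 1 := hδ.trans (min_le_left _ _)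
  have hδ2 : δ * (8 * N ^ 2 * Cι * C₃) ≤ 1 :=
    (le_div_iff₀ (by positivity)).1 (hδ.trans (min_le_right _ _))
  have hball : ∀ q ∈ P, Metric.closedBall q ρ₁ ⊆ S.dom := fun q hq =>
    (Metric.closedBall_subset_ball (by linarith)).trans (hdom q hq)
  have hfψ : ∀ q ∈ P, ∀ p ∈ Metric.closedBall q ρ₁, ∀ i, ‖fderiv ℝ (ψ i) p‖ ≤ D := by
    intro q hq p hp i
    have hsub : Metric.closedBall p h ⊆ S.dom := by
      refine (Metric.closedBall_subset_ball' ?_).trans (hdom q hq)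
      have := Metric.mem_closedBall.1 hp
      rw [hh]
      linarith
    refine norm_fderiv_le_of_norm_iteratedFDeriv_two_le hh0 (fun x hx => (h4 x (hsub hx) i).1)
      (fun x hx => ?_) (fun x hx => ?_)
    · linarith [(h4 x (hsub hx) i).2, norm_nonneg (iteratedFDeriv ℝ 2 (ψ i) x)]
    · linarith [(h4 x (hsub hx) i).2, norm_nonneg (ψ i x)]
  have hfΦ : ∀ p ∈ S.dom, ‖fderiv ℝ S.Φ p‖ ≤ Λ := fun p hp =>
    Framework.norm_fderiv_Φ_le hC₃.le hC₄.le hδ1 h3 h4 hp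
  obtain ⟨π, hπc, hπΦ, hπ⟩ := exists_projection (P := P) (dom := S.dom) (Φ := S.Φ)
    (g := S.defect ψ) hη0 hρ₁0 hM0.le (by linarith) hball
    (by
      intro q hq u hu p hp p' hp'
      refine (Framework.norm_add_defect_sub_le hι hρ₁0.le (hball q hq) (fun p hp => (hψ p hp).2)
        h3 (fun p hp i => (h4 p hp i).1.differentiableAt (by simp)) (hfψ q hq)
        (fun p hp => hfΦ p (hball q hq hp)) hu.le hp hp').trans ?_
      refine mul_le_mul_of_nonneg_right ?_ (norm_nonneg _)
      -- Each of the three smallness conditions, on `δ`, `η` and `ρ₁`, contributes at most `1/8`.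
      calc (n : ℝ) * (n * (Cι * (C₃ * δ)) + Cι ^ 2 * D * (η + Λ * ρ₁))
          ≤ N * (N * (Cι * (C₃ * δ)) + Cι ^ 2 * D * (η + Λ * ρ₁)) := by gcongr
        _ = (δ * (8 * N ^ 2 * Cι * C₃) + η * (8 * N * Cι ^ 2 * D)
            + ρ₁ * (8 * N * Cι ^ 2 * D * Λ)) / 8 := by ring
        _ ≤ 1 / 2 := by linarith)
    (fun p hp u u' => (Framework.norm_defect_sub_le hι (hψ p hp).2 u u').trans (by
      rw [hM]; gcongr))
    (Framework.defect_self ψ)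
    (fun p hp q hq hpq => by linarith [hemb _ (half_pos hρ₁0) p hp q hq hpq])
  have hnear : ∀ u ∈ S.nbhd a P η, ∃ q ∈ P, ‖u - S.Φ q‖ < η := by
    intro u hu
    obtain ⟨_, ⟨q, hq, rfl⟩, hd⟩ := Metric.mem_thickening_iff.1 hu.2
    exact ⟨q, hq, by rwa [← dist_eq_norm]⟩
  have hdev : ∀ u, ∀ q ∈ P, ‖u - S.Φ q‖ < η → ‖S.dev π u‖ ≤ c₁ * ‖u - S.Φ q‖ := by
    intro u q hq hu
    obtain ⟨hm1, -, hm3⟩ := hπ u q hq hu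
    have hΦl := (convex_closedBall q ρ₁).norm_image_sub_le_of_norm_fderiv_le (𝕜 := ℝ)
      (fun p hp => (S.Φ_smooth p (hball q hq hp)).differentiableAt (by simp))
      (fun p hp => hfΦ p (hball q hq hp)) hm1 (Metric.mem_closedBall_self hρ₁0.le)
    rw [norm_sub_rev q] at hΦl
    calc ‖S.dev π u‖ ≤ ‖u - S.Φ q‖ + ‖S.Φ q - S.Φ (π u)‖ := norm_sub_le_norm_sub_add_norm_sub _ _ _
      _ ≤ ‖u - S.Φ q‖ + Λ * (2 * M * ‖u - S.Φ q‖) := by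
          gcongr
          exact hΦl.trans (mul_le_mul_of_nonneg_left hm3 hΛ0.le)
      _ = _ := by rw [hc₁]; ring
  have hproj : S.IsProjection (S.nbhd a P η) π := by
    refine ⟨fun u hu => ?_, hπc.mono inter_subset_right, fun q hq hmem => hπΦ q hq hmem.2⟩
    obtain ⟨q, hq, hu'⟩ := hnear u hu
    exact hball q hq (hπ u q hq hu').1
  have hA1 : S.A1 (S.nbhd a P η) P π c₁ := by
    intro u hu
    obtain ⟨q₀, hq₀, -⟩ := hnear u hu
    have hP : P.Nonempty := ⟨q₀, hq₀⟩
    rw [← div_le_iff₀' hc₁0]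
    by_contra! hcon
    -- The distance need not be attained, so a nearly optimal `q` is taken that also satisfies `‖u -
    -- Φ q‖ < η`, as `hdev` demands.
    obtain ⟨_, ⟨q, hq, rfl⟩, hd⟩ := (Metric.infDist_lt_iff (hP.image S.Φ)).1
      (lt_min hcon ((Framework.mem_nbhd_iff hP).1 hu).2)
    rw [dist_eq_norm] at hd
    have := hdev u q hq (hd.trans_le (min_le_right _ _))
    have h5 := hd.trans_le (min_le_left _ _)
    rw [lt_div_iff₀' hc₁0] at h5
    linarith
  have hA2 : S.A2 (S.nbhd a P η) π (Cι ^ 2 * C₀ * δ) (μe * ks / (2 * (ks + γe)))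
      (Cι ^ 2 * CS) (r + 1) := by
    intro u hu
    obtain ⟨q, hq, huq⟩ := hnear u hu
    obtain ⟨hm1, hm2, -⟩ := hπ u q hq huq
    have hpd := hball q hq hm1
    have hwH : S.dev π u ∈ S.H₀ := by
      have h5 : S.dev π u = (u - a) - (S.Φ (π u) - a) := by
        simp only [Framework.dev]; abel
      rw [h5]
      exact S.H₀.sub_mem hu.1 (hE _ hpd)
    have hperp : ∀ i, inner ℝ (S.ι (ψ i (π u))) (S.ι (S.dev π u)) = 0 := fun i => by
      have := congrArg (fun x : Param n => x i) hm2
      simpa [Framework.dev] using this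
    have hwε : ‖S.dev π u‖ ≤ εS :=
      (hdev u q hq huq).trans (le_trans (by nlinarith) hη4)
    refine ⟨Framework.abs_dJ_le hι h0 hpd hwH,
      Framework.normalSpace_coercive hks hγe hμe h1 h2 hψ hEA hpd hwH hperp,
      S.J u - S.J (S.Φ (π u)) - S.dJ (S.Φ (π u)) (S.dev π u)
        - 1 / 2 * S.d2J (S.Φ (π u)) (S.dev π u) (S.dev π u), by ring, ?_⟩
    have h5 := Framework.abs_energy_remainder_le hι hCS.le hr hNL hpd hwH hwε
    have h6 : S.Φ (π u) + S.dev π u = u := by simp [Framework.dev]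
    rwa [h6] at h5
  refine ⟨π, hproj, hA1, hA2, ?_⟩
  intro δ₀ δ₁ _ _ hA0 hlt G hG τ u hτ hu hu0 hJ0
  exact hu.stays_near hc₁0 (by positivity) (by positivity) (by linarith) hproj.2.1 hA0 hA1 hA2
    hlt hG hτ hu0 hJ0
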